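/- **Model.** For $\epsilon,\delta\in\mathbb R$ let $$\mathcal R(\epsilon,\delta)=\{(x,y)\in[0,1]^2:\ x+e^{\epsilon}y\ge 1-\delta,\ y+e^{\epsilon}x\ge 1-\delta,\ y+e^{\epsilon}x\le e^{\epsilon}+\delta,\ x+e^{\epsilon}y\le e^{\epsilon}+\delta\},$$ $\mathcal R_s(\epsilon,\delta)=\mathcal R(\epsilon,\delta)\setminus\mathcal R(s\epsilon,s\delta)$, and let $|\cdot|$ denote area. Fix $n\ge 1$, $\delta\in[0,1]$, $\sigma_\epsilon^2,a,b>0$ and, for $i=1,\dots,n$, integers $0\le X_i\le N_{i,0}$ and $0\le Y_i\le N_{i,1}$. Let $p(\epsilon)$ be the density of the one-sided normal distribution $\mathcal N_{[0,\infty)}(0,\sigma_\epsilon^2)$, $p(s)$ that of $\mathrm{Beta}(a,b)$, $p_\delta(\alpha,\beta\mid\epsilon,s)=\mathbb I\{(\alpha,\beta)\in\mathcal R_s(\epsilon,\delta)\}/|\mathcal R_s(\epsilon,\delta)|$, and $g(X_i,Y_i\mid\alpha,\beta)=\mathrm{Binom}(X_i\mid N_{i,0},\alpha)\,\mathrm{Binom}(Y_i\mid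 N_{i,1},\beta)$. The joint posterior $\pi=p_\delta(\epsilon,s,\alpha_{1:n},\beta_{1:n}\mid X_{1:n},Y_{1:n})$ is the distribution whose Lebesgue density is proportional to $$p(\epsilon)\,p(s)\prod_{i=1}^n p_\delta(\alpha_i,\beta_i\mid\epsilon,s)\,g(X_i,Y_i\mid\alpha_i,\beta_i).$$ Let $S$ be the set of states $(\epsilon,s,\alpha_{1:n},\beta_{1:n})$ with $\epsilon>0$ at which this expression is positive. **Algorithm (MCMC-DP-Est).** Fix an integer $K>1$ and proposal variances $\sigma_{q,\epsilon}^2,\sigma_{q,s}^2>0$. One iteration from the state $(\epsilon,s,\alpha_{1:n},\beta_{1:n})$ is as follows. 1. Draw $\epsilon'$ with $\log\epsilon'\sim\mathcal N(\log\epsilon,\sigma_{q,\epsilon}^2)$ and $s'\sim\mathcal N(s,\sigma_{q,s}^2)$. 2. For every $j$ put $(\alpha_j^{(1)},\beta_j^{(1)})=(\alpha_j,\beta_j)$, draw $\alpha_j^{(k)},\beta_j^{(k)}\sim\mathrm{Unif}(0,1)$ for $k=2,\dots,K$, and compute, for $k=1,\dots,K$, the weights $w_j^{(k)}=p_\delta(\alpha_j^{(k)},\beta_j^{(k)}\mid\epsilon,s)\,g(X_j,Y_j\mid\alpha_j^{(k)},\beta_j^{(k)})$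 and $w_j'^{(k)}=p_\delta(\alpha_j^{(k)},\beta_j^{(k)}\mid\epsilon',s')\,g(X_j,Y_j\mid\alpha_j^{(k)},\beta_j^{(k)})$. 3. Draw $u\sim\mathrm{Unif}(0,1)$. If $$u\le A=\min\Big\{1,\ \frac{p(s')p(\epsilon')\epsilon'}{p(s)p(\epsilon)\epsilon}\prod_{j=1}^n\frac{\sum_{k=1}^K w_j'^{(k)}}{\sum_{k=1}^K w_j^{(k)}}\Big\},$$ replace $(\epsilon,s)$ by $(\epsilon',s')$ and put $\bar w=w'$; otherwise keep $(\epsilon,s)$ and put $\bar w=w$. 4. For every $j$, independently, select $k\in\{1,\dots,K\}$ with probability proportional to $\bar w_j^{(k)}$, and replace $(\alpha_j,\beta_j)$ by $(\alpha_j^{(k)},\beta_j^{(k)})$. All draws are independent. Let $P$ be the Markov transition kernel of one iteration. **Proposition.** $P$ is an ergodic Markov kernel on $S$ whose invariant distribution is exactly $\pi$. That is: - $\pi$ is a well-defined probability measure carried by $S$, and the chain started in $S$ stays in $S$; - $\pi P=\pi$, and $\pi$ is the only invariant probability measure of $P$ carried by $S$; - $P$ is $\pi$-irreducible on $S$ and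 aperiodic; - $\|P^m(x,\cdot)-\pi\|_{TV}\to0$ as $m\to\infty$ for $\pi$-almost every initial state $x$. Moreover, for every initial value $(\epsilon,s)\in(0,\infty)\times(0,1)$, this convergence holds for Lebesgue-almost every $(\alpha_{1:n},\beta_{1:n})$ such that $x=(\epsilon,s,\alpha_{1:n},\beta_{1:n})\in S$. -/

import Mathlib

open MeasureTheory ProbabilityTheory Filter Topology
open scoped ENNReal NNReal

noncomputable section

namespace DPEst

/-! ### Error regions of differential privacy -/

/-- The region `R(ε, δ)` of error probability pairs `(x, y)` compatible with `(ε, δ)`-DP. -/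
def errorRegion (ε δ : ℝ) : Set (ℝ × ℝ) :=
  {p | p ∈ Set.Icc (0 : ℝ) 1 ×ˢ Set.Icc (0 : ℝ) 1 ∧
    1 - δ ≤ p.1 + Real.exp ε * p.2 ∧ 1 - δ ≤ p.2 + Real.exp ε * p.1 ∧
    p.2 + Real.exp ε * p.1 ≤ Real.exp ε + δ ∧ p.1 + Real.exp ε * p.2 ≤ Real.exp ε + δ}

/-- `R_s(ε, δ) = R(ε, δ) \ R(sε, sδ)`. -/
def strongRegion (δ ε s : ℝ) : Set (ℝ × ℝ) :=
  errorRegion ε δ \ errorRegion (s * ε) (s * δ)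

/-- The density `p_δ(α, β | ε, s)` of the uniform distribution on `R_s(ε, δ)`, as a function of
`θ = (ε, s)` and `z = (α, β)`; the normalising constant is the area of `R_s(ε, δ)`. -/
def errorPrior (δ : ℝ) (θ z : ℝ × ℝ) : ℝ :=
  (strongRegion δ θ.1 θ.2).indicator (fun _ => 1 / volume.real (strongRegion δ θ.1 θ.2)) z

/-- The probability mass of `Binom(N, p)` at `x`. -/
def binomPMF (N : ℕ) (p : ℝ) (x : ℕ) : ℝ :=
  (N.choose x : ℝ) * p ^ x * (1 - p) ^ (N - x)

/-- The density of the one-sided normal distribution `N_{[0, ∞)}(0, σ²)`: the centred normal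
distribution conditioned on `[0, ∞)`. -/
def oneSidedNormalPDF (σ2 : ℝ≥0) (ε : ℝ) : ℝ :=
  (Set.Ici (0 : ℝ)).indicator
    (fun e => gaussianPDFReal 0 σ2 e / (gaussianReal 0 σ2).real (Set.Ici 0)) ε

/-! ### The hierarchical model -/

/-- The fixed quantities of the hierarchical model with `n` attacks: the parameter `δ`, the
hyperparameters `σ2`, `a`, `b` of the priors of `ε` and `s`, the numbers of challenges `N0 i`,
`N1 i` under the two hypotheses, and the observed false positive and false negative counts
`X i`, `Y i`. -/
structure Model (n : ℕ) where
  δ : ℝ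
  σ2 : ℝ≥0
  a : ℝ
  b : ℝ
  N0 : Fin n → ℕ
  N1 : Fin n → ℕ
  X : Fin n → ℕ
  Y : Fin n → ℕ

/-- A state `((ε, s), z)` of the chain, where `z i = (α i, β i)`. -/
abbrev State (n : ℕ) : Type := (ℝ × ℝ) × (Fin n → ℝ × ℝ)

variable {n : ℕ}

/-- The prior density `p(ε) p(s)` of `θ = (ε, s)`. -/
def Model.paramPrior (M : Model n) (θ : ℝ × ℝ) : ℝ :=
  oneSidedNormalPDF M.σ2 θ.1 * betaPDFReal M.a M.b θ.2

/-- The likelihood `g(X i, Y i | α, β)` of the `i`-th pair of error counts given `z = (α, β)`. -/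
def Model.lik (M : Model n) (i : Fin n) (z : ℝ × ℝ) : ℝ :=
  binomPMF (M.N0 i) z.1 (M.X i) * binomPMF (M.N1 i) z.2 (M.Y i)

/-- The factor `p_δ(α, β | ε, s) g(X i, Y i | α, β)`; these are also the weights of the
algorithm. -/
def Model.weight (M : Model n) (i : Fin n) (θ z : ℝ × ℝ) : ℝ :=
  errorPrior M.δ θ z * M.lik i z

/-- The joint density
`p(ε) p(s) ∏ i, p_δ(α i, β i | ε, s) g(X i, Y i | α i, β i)` at the observed counts. -/
def Model.jointDensity (M : Model n) (x : State n) : ℝ :=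
  M.paramPrior x.1 * ∏ i, M.weight i x.1 (x.2 i)

/-- The unnormalised posterior: the measure with density `jointDensity` with respect to Lebesgue
measure. -/
def Model.jointMeasure (M : Model n) : Measure (State n) :=
  volume.withDensity fun x => ENNReal.ofReal (M.jointDensity x)

/-- The joint posterior distribution of `(ε, s, α_{1:n}, β_{1:n})` given the observed counts. -/
def Model.posterior (M : Model n) : Measure (State n) :=
  (M.jointMeasure Set.univ)⁻¹ • M.jointMeasure

/-- The state space of the chain: the states with `ε > 0` (so that `log ε` makes sense) of positive
posterior density. -/
def Model.stateSpace (M : Model n) : Set (State n) :=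
  {x | 0 < x.1.1 ∧ 0 < M.jointDensity x}

/-! ### One iteration of the algorithm -/

/-- The uniform distribution on `(0, 1)`. -/
def unif : Measure ℝ := volume.restrict (Set.Ioo 0 1)

/-- `m ↦ N(m, v)`. -/
def gaussianKernel (v : ℝ≥0) : Kernel ℝ ℝ where
  toFun m := gaussianReal m v
  measurable' := measurable_gaussianReal.comp (measurable_id.prodMk measurable_const)

/-- The proposal `θ = (ε, s) ↦ (ε', s')` with `ε' ∼ logN(log ε, vε)` (that is,
`log ε' ∼ N(log ε, vε)`) and `s' ∼ N(s, vs)` independently. -/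
def proposal (vε vs : ℝ≥0) : Kernel (ℝ × ℝ) (ℝ × ℝ) :=
  (((gaussianKernel vε).map Real.exp).comap (fun θ : ℝ × ℝ => Real.log θ.1)
      (Real.measurable_log.comp measurable_fst)) ×ₖ
    ((gaussianKernel vs).comap Prod.snd measurable_snd)

/-- Indices of the fresh auxiliary points. Index `0` is reserved for the current point. -/
abbrev Fresh (K : ℕ) : Type := {k : Fin K // (k : ℕ) ≠ 0}

/-- The random draws `((ε', s'), fresh points, u)` preceding the accept/reject decision. -/
abbrev Draw (n K : ℕ) : Type := (ℝ × ℝ) × (Fin n → Fresh K → ℝ × ℝ) × ℝ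

/-- The law of the draws: the proposal, `K - 1` independent uniform points of the unit square for
every `j`, and a uniform variable, all independent. -/
def draws (n K : ℕ) (vε vs : ℝ≥0) : Kernel (State n) (Draw n K) :=
  ((proposal vε vs).comap Prod.fst measurable_fst) ×ₖ
    Kernel.const (State n)
      ((Measure.pi fun _ : Fin n => Measure.pi fun _ : Fresh K => unif.prod unif).prod unif)

/-- The points `(α_j^{(k)}, β_j^{(k)})`: the current point for the first index, and the fresh
points for the others. -/
def points {K : ℕ} (x : State n) (d : Draw n K) (j : Fin n) (k : Fin K) : ℝ × ℝ :=
  if h : (k : ℕ) = 0 then x.2 j else d.2.1 j ⟨k, h⟩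

/-- The acceptance probability. -/
def Model.acceptProb (M : Model n) {K : ℕ} (x : State n) (d : Draw n K) : ℝ :=
  min 1 ((M.paramPrior d.1 * d.1.1) / (M.paramPrior x.1 * x.1.1) *
    ∏ j, (∑ k, M.weight j d.1 (points x d j k)) / (∑ k, M.weight j x.1 (points x d j k)))

open Classical in
/-- The value of `(ε, s)` after the accept/reject step `u ≤ A`. -/
def Model.newParam (M : Model n) {K : ℕ} (x : State n) (d : Draw n K) : ℝ × ℝ :=
  if d.2.2 ≤ M.acceptProb x d then d.1 else x.1

/-- The weights `w̄_j^{(k)}`: those of the proposal if it was accepted, and those of the current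
parameter otherwise. -/
def Model.newWeight (M : Model n) {K : ℕ} (x : State n) (d : Draw n K) (j : Fin n) (k : Fin K) :
    ℝ :=
  M.weight j (M.newParam x d) (points x d j k)

open Classical in
/-- Probabilities proportional to the nonnegative numbers `w k`. If all of them vanish, the uniform
distribution is used by convention; this only matters outside the state space of the chain. -/
def selectProb {K : ℕ} (w : Fin K → ℝ) (k : Fin K) : ℝ :=
  if ∑ l, w l = 0 then 1 / K else w k / ∑ l, w l

/-- The distribution on `{1, …, K}` with probabilities `selectProb w`. -/
def selectLaw {K : ℕ} (w : Fin K → ℝ) : Measure (Fin K) :=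
  ∑ k, ENNReal.ofReal (selectProb w k) • Measure.dirac k

instance {K : ℕ} (w : Fin K → ℝ) : IsFiniteMeasure (selectLaw w) := by
  refine ⟨?_⟩
  simp [selectLaw, ENNReal.sum_lt_top]

/-- The law of the new state given the current state and the draws: for every `j`, independently,
select an index with probability proportional to `w̄_j`, and keep the corresponding point. -/
def Model.resampleLaw (M : Model n) {K : ℕ} (x : State n) (d : Draw n K) : Measure (State n) :=
  (Measure.pi fun j => selectLaw (M.newWeight x d j)).map
    fun k => (M.newParam x d, fun j => points x d j (k j))

/-! Measurability of the ingredients of one iteration. -/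

theorem measurableSet_errorRegion_comp {Ω : Type*} [MeasurableSpace Ω] {e d : Ω → ℝ}
    {z : Ω → ℝ × ℝ} (he : Measurable e) (hd : Measurable d) (hz : Measurable z) :
    MeasurableSet {ω | z ω ∈ errorRegion (e ω) (d ω)} := by
  have hE : Measurable fun ω => Real.exp (e ω) := he.exp
  have h1 : Measurable fun ω => (z ω).1 := hz.fst
  have h2 : Measurable fun ω => (z ω).2 := hz.snd
  have hA : Measurable fun ω => (z ω).1 + Real.exp (e ω) * (z ω).2 := h1.add (hE.mul h2)
  have hB : Measurable fun ω => (z ω).2 + Real.exp (e ω) * (z ω).1 := h2.add (hE.mul h1)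
  have hL : Measurable fun ω => 1 - d ω := measurable_const.sub hd
  have hU : Measurable fun ω => Real.exp (e ω) + d ω := hE.add hd
  exact (hz (measurableSet_Icc.prod measurableSet_Icc)).inter
    ((measurableSet_le hL hA).inter ((measurableSet_le hL hB).inter
      ((measurableSet_le hB hU).inter (measurableSet_le hA hU))))

theorem measurableSet_strongRegion_prod (δ : ℝ) :
    MeasurableSet {p : (ℝ × ℝ) × (ℝ × ℝ) | p.2 ∈ strongRegion δ p.1.1 p.1.2} :=
  MeasurableSet.diff
    (measurableSet_errorRegion_comp (e := fun p : (ℝ × ℝ) × (ℝ × ℝ) => p.1.1)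
      (d := fun _ => δ) (z := Prod.snd) (by fun_prop) (by fun_prop) (by fun_prop))
    (measurableSet_errorRegion_comp (e := fun p : (ℝ × ℝ) × (ℝ × ℝ) => p.1.2 * p.1.1)
      (d := fun p => p.1.2 * δ) (z := Prod.snd) (by fun_prop) (by fun_prop) (by fun_prop))

theorem measurable_errorPrior (δ : ℝ) :
    Measurable fun p : (ℝ × ℝ) × (ℝ × ℝ) => errorPrior δ p.1 p.2 := by
  have hS := measurableSet_strongRegion_prod δ
  have hV : Measurable fun θ : ℝ × ℝ => volume.real (strongRegion δ θ.1 θ.2) :=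
    (measurable_measure_prodMk_left hS).ennreal_toReal
  exact Measurable.indicator (f := fun p : (ℝ × ℝ) × (ℝ × ℝ) =>
    1 / volume.real (strongRegion δ p.1.1 p.1.2)) (by
      exact measurable_const.div (hV.comp measurable_fst)) hS

theorem Model.measurable_weight (M : Model n) (i : Fin n) :
    Measurable fun p : (ℝ × ℝ) × (ℝ × ℝ) => M.weight i p.1 p.2 := by
  have := measurable_errorPrior M.δ
  unfold Model.weight Model.lik binomPMF
  fun_prop

theorem Model.measurable_paramPrior (M : Model n) : Measurable M.paramPrior := by
  have h1 : Measurable (oneSidedNormalPDF M.σ2) :=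
    ((measurable_gaussianPDFReal 0 M.σ2).div_const _).indicator measurableSet_Ici
  exact (h1.comp measurable_fst).mul ((measurable_betaPDFReal M.a M.b).comp measurable_snd)

theorem measurable_points {K : ℕ} (j : Fin n) (k : Fin K) :
    Measurable fun p : State n × Draw n K => points p.1 p.2 j k := by
  unfold points
  split_ifs <;> fun_prop

theorem Model.measurable_weight_points (M : Model n) {K : ℕ} {θ : State n × Draw n K → ℝ × ℝ}
    (hθ : Measurable θ) (j : Fin n) (k : Fin K) :
    Measurable fun p : State n × Draw n K => M.weight j (θ p) (points p.1 p.2 j k) :=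
  Measurable.comp (g := fun q : (ℝ × ℝ) × (ℝ × ℝ) => M.weight j q.1 q.2)
    (f := fun p : State n × Draw n K => (θ p, points p.1 p.2 j k))
    (M.measurable_weight j) (hθ.prodMk (measurable_points j k))

theorem Model.measurable_acceptProb (M : Model n) {K : ℕ} :
    Measurable fun p : State n × Draw n K => M.acceptProb p.1 p.2 := by
  have h1 := M.measurable_paramPrior
  have hx : Measurable fun p : State n × Draw n K => p.1.1 := measurable_fst.comp measurable_fst
  have hd : Measurable fun p : State n × Draw n K => p.2.1 := measurable_fst.comp measurable_snd
  unfold Model.acceptProb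
  refine measurable_const.min (Measurable.mul ?_ ?_)
  · exact ((h1.comp hd).mul hd.fst).div ((h1.comp hx).mul hx.fst)
  · exact Finset.measurable_prod _ fun j _ =>
      (Finset.measurable_sum _ fun k _ => M.measurable_weight_points hd j k).div
        (Finset.measurable_sum _ fun k _ => M.measurable_weight_points hx j k)

theorem Model.measurable_newParam (M : Model n) {K : ℕ} :
    Measurable fun p : State n × Draw n K => M.newParam p.1 p.2 := by
  classical
  have hx : Measurable fun p : State n × Draw n K => p.1.1 := measurable_fst.comp measurable_fst
  have hd : Measurable fun p : State n × Draw n K => p.2.1 := measurable_fst.comp measurable_snd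
  have hu : Measurable fun p : State n × Draw n K => p.2.2.2 :=
    measurable_snd.comp (measurable_snd.comp measurable_snd)
  exact Measurable.ite (measurableSet_le hu M.measurable_acceptProb) hd hx

theorem Model.measurable_newWeight (M : Model n) {K : ℕ} (j : Fin n) (k : Fin K) :
    Measurable fun p : State n × Draw n K => M.newWeight p.1 p.2 j k :=
  M.measurable_weight_points M.measurable_newParam j k

theorem measurable_selectProb {K : ℕ} (k : Fin K) :
    Measurable fun w : Fin K → ℝ => selectProb w k := by
  classical
  exact Measurable.ite (measurableSet_eq_fun (by fun_prop) (by fun_prop))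
    (by fun_prop) (by fun_prop)

theorem selectLaw_singleton {K : ℕ} (w : Fin K → ℝ) (k : Fin K) :
    selectLaw w {k} = ENNReal.ofReal (selectProb w k) := by
  classical
  simp [selectLaw, Measure.finsetSum_apply, Set.indicator_apply]

theorem Model.resampleLaw_apply (M : Model n) {K : ℕ} (x : State n) (d : Draw n K)
    {A : Set (State n)} (hA : MeasurableSet A) :
    M.resampleLaw x d A = ∑ k : Fin n → Fin K,
      (∏ j, ENNReal.ofReal (selectProb (M.newWeight x d j) (k j))) *
        A.indicator (fun _ => 1) (M.newParam x d, fun j => points x d j (k j)) := by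
  classical
  unfold Model.resampleLaw
  rw [Measure.map_apply (measurable_of_finite _) hA]
  rw [← lintegral_indicator_one (Set.toFinite _).measurableSet, lintegral_fintype]
  refine Finset.sum_congr rfl fun k _ => ?_
  rw [Measure.pi_singleton, mul_comm]
  simp only [selectLaw_singleton]
  rfl

theorem Model.measurable_resampleLaw (M : Model n) {K : ℕ} :
    Measurable fun p : State n × Draw n K => M.resampleLaw p.1 p.2 := by
  refine Measure.measurable_of_measurable_coe _ fun A hA => ?_
  simp only [M.resampleLaw_apply _ _ hA]
  refine Finset.measurable_sum _ fun k _ => Measurable.mul ?_ ?_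
  · refine Finset.measurable_prod _ fun j _ => ENNReal.measurable_ofReal.comp ?_
    exact (measurable_selectProb (k j)).comp
      (measurable_pi_lambda _ fun l => M.measurable_newWeight j l)
  · exact (measurable_const.indicator hA).comp (M.measurable_newParam.prodMk
      (measurable_pi_lambda _ fun j => measurable_points j (k j)))

/-- `Model.resampleLaw` as a transition kernel. -/
def Model.resample (M : Model n) (K : ℕ) : Kernel (State n × Draw n K) (State n) where
  toFun p := M.resampleLaw p.1 p.2
  measurable' := M.measurable_resampleLaw

/-- The transition kernel of one iteration of `MCMC-DP-Est`, with `K` auxiliary variables and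
proposal variances `vε` (for `log ε`) and `vs` (for `s`). -/
def Model.mcmcKernel (M : Model n) (K : ℕ) (vε vs : ℝ≥0) : Kernel (State n) (State n) :=
  M.resample K ∘ₖ (Kernel.id ×ₖ draws n K vε vs)

/-! ### Ergodicity -/

/-- The total variation distance, as the supremum over all events (for probability measures). -/
def tvDist {Ω : Type*} [MeasurableSpace Ω] (μ ν : Measure Ω) : ℝ :=
  ⨆ A : {A : Set Ω // MeasurableSet A}, |μ.real A - ν.real A|

/-- The Markov chain with transition kernel `P`, run on the state space `S`, is ergodic with
invariant distribution `π`. -/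
structure IsErgodicChain {Ω : Type*} [MeasurableSpace Ω] (P : Kernel Ω Ω) (S : Set Ω)
    (π : Measure Ω) : Prop where
  /-- `P` is a Markov kernel. -/
  markov : IsMarkovKernel P
  measurableSet : MeasurableSet S
  /-- The chain never leaves `S`. -/
  closed : ∀ x ∈ S, P x Sᶜ = 0
  /-- `π` is a probability measure on `S`. -/
  prob : IsProbabilityMeasure π
  carried : π Sᶜ = 0
  /-- `π` is invariant. -/
  invariant : P.Invariant π
  /-- `π` is the only invariant distribution on `S`. -/
  unique : ∀ μ : Measure Ω, IsProbabilityMeasure μ → μ Sᶜ = 0 → P.Invariant μ → μ = π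
  /-- The chain is `π`-irreducible on `S`. -/
  irreducible : ∀ x ∈ S, ∀ A, MeasurableSet A → 0 < π A → ∃ m : ℕ, 0 < m ∧ 0 < (P ^ m) x A
  /-- The chain is aperiodic: there is no cycle of `d ≥ 2` disjoint non-null sets. -/
  aperiodic : ∀ d : ℕ, 2 ≤ d → ∀ D : ZMod d → Set Ω, (∀ i, MeasurableSet (D i)) →
    Pairwise (fun i j => Disjoint (D i) (D j)) → (∀ i, ∀ x ∈ D i, P x (D (i + 1))ᶜ = 0) →
    ∀ i, π (D i) = 0
  /-- The law of the chain after `m` steps converges to `π` in total variation, from almost every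
  initial state. -/
  convergence : ∀ᵐ x ∂π, Tendsto (fun m : ℕ => tvDist ((P ^ m) x) π) atTop (𝓝 0)

end DPEst

end

namespace DPEst

/-! ### Total variation along a countable family of events, and common parts of measures -/

section Chain

variable {Ω : Type*} [MeasurableSpace Ω]

/-! Invariance. Let the state have the posterior law and add the uniform points. After averaging
over the position of the current point in each group, `θ` and the array of points have a density
proportional to `p(θ) ∏ j, ∑ k, w_j^(k)(θ)`, and given these the position has exactly the selection
probabilities. So one iteration is a Metropolis step on `θ` with the array held fixed, followed by
an exact redraw of the position. In the coordinate `log ε` the proposal is symmetric, and the factor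
`ε'/ε` in the acceptance ratio is the Jacobian. This is carried by `lintegral_sum_select_mul`,
`Model.detailed_balance` and `lintegral_metropolis`.

Domination. From any state of `S`, accepting the proposal and selecting the first fresh point in
every group has positive density wherever the posterior has, so `π ≪ P x` for every `x ∈ S`
(`Model.jointMeasure_absolutelyContinuous`). Irreducibility in one step and the absence of cycles
follow at once. For uniqueness, the two Jordan parts of a difference of invariant laws are
invariant; if nonzero, both dominate `π` although they are mutually singular.

Convergence. For two independent copies of the chain, the limsup `F` of the discrepancy between the
laws started at `x` and `y` is bounded and subharmonic, hence almost surely equal to a constant `c`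
(`null_or_null_of_subharmonic`). Since `P x` and `P y` both dominate `π`, they share a part of
positive mass; cancelling it gives `F (x, y) < c` unless `c = 0` (`limGap_ae_eq_zero`).

Initial values. The limsup `h` of the discrepancy between `P ^ m` and `π` is subharmonic and
vanishes almost everywhere. To reach every `θ`, integrate `h ≤ P h` against the weights at fixed
`θ`: accepted moves contribute nothing, because the proposal has a density, and rejected moves carry
only part of the mass of `h`. As acceptance has positive probability, `h` vanishes at almost every
point over `θ` (`Model.ae_points_eq_zero_of_subharmonic`). -/

theorem exists_countable_measureDense_algebra [MeasurableSpace.CountablyGenerated Ω] :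
    ∃ A : ℕ → Set Ω, (∀ i, MeasurableSet (A i)) ∧
      ∀ μ : Measure Ω, IsFiniteMeasure μ → μ.MeasureDense (Set.range A) := by
  obtain ⟨b, hb, hgen⟩ := MeasurableSpace.CountablyGenerated.isCountablyGenerated (α := Ω)
  have hcount := countable_generateSetAlgebra hb
  have halg : IsSetAlgebra (generateSetAlgebra b) := isSetAlgebra_generateSetAlgebra
  obtain ⟨A, hA⟩ := hcount.exists_eq_range ⟨∅, halg.empty_mem⟩
  have hgen' : ‹MeasurableSpace Ω› = MeasurableSpace.generateFrom (generateSetAlgebra b) := by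
    rw [generateFrom_generateSetAlgebra_eq, hgen]
  refine ⟨A, fun i => ?_, fun μ _ => ?_⟩
  · rw [hgen']
    exact MeasurableSpace.measurableSet_generateFrom (hA ▸ Set.mem_range_self i)
  · rw [← hA]
    exact Measure.MeasureDense.of_generateFrom_isSetAlgebra_finite μ halg hgen'

/-- Equal masses let both integrals be lifted to the product measure with the same factor; truncated
subtraction is then subadditive under the integral. -/
theorem lintegral_sub_lintegral_le_prod {α β : Type*} [MeasurableSpace α] [MeasurableSpace β]
    (μ : Measure α) (ν : Measure β) [IsFiniteMeasure μ] [IsFiniteMeasure ν]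
    (hmass : μ Set.univ = ν Set.univ) {f : α → ℝ≥0∞} {g : β → ℝ≥0∞}
    (hf : Measurable f) (hg : Measurable g) :
    μ Set.univ * (∫⁻ x, f x ∂μ - ∫⁻ y, g y ∂ν) ≤ ∫⁻ q, (f q.1 - g q.2) ∂(μ.prod ν) := by
  have h1 : ∫⁻ q, f q.1 ∂(μ.prod ν) = μ Set.univ * ∫⁻ x, f x ∂μ := by
    rw [lintegral_prod _ (by fun_prop)]
    simp only [lintegral_const]
    rw [lintegral_mul_const _ hf, hmass, mul_comm]
  have h2 : ∫⁻ q, g q.2 ∂(μ.prod ν) = μ Set.univ * ∫⁻ y, g y ∂ν := by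
    rw [lintegral_prod _ (by fun_prop)]
    simp only [lintegral_const]
    rw [mul_comm]
  rw [ENNReal.mul_sub (fun _ _ => measure_ne_top _ _), ← h1, ← h2]
  exact lintegral_sub_le _ _ (by fun_prop)

/-- One-sided discrepancy of two measures along a sequence of events. -/
noncomputable def gap (A : ℕ → Set Ω) (μ ν : Measure Ω) : ℝ≥0∞ := ⨆ i, (μ (A i) - ν (A i))

theorem gap_le_one (A : ℕ → Set Ω) (μ ν : Measure Ω) [IsProbabilityMeasure μ] :
    gap A μ ν ≤ 1 :=
  iSup_le fun _ => tsub_le_self.trans prob_le_one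

/-- A countable supremum keeps the discrepancy measurable in the starting point. Nothing is lost, as
each event is approximated by some `A i` for `μ + ν`, hence for both measures at once. -/
theorem tvDist_le_gap {A : ℕ → Set Ω}
    (hA : ∀ μ : Measure Ω, IsFiniteMeasure μ → μ.MeasureDense (Set.range A))
    (μ ν : Measure Ω) [IsProbabilityMeasure μ] [IsProbabilityMeasure ν] :
    tvDist μ ν ≤ (gap A μ ν).toReal := by
  have hfin : gap A μ ν ≠ ∞ := ne_top_of_le_ne_top ENNReal.one_ne_top (gap_le_one A μ ν)
  have hone : ∀ B, MeasurableSet B → μ.real B - ν.real B ≤ (gap A μ ν).toReal := by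
    intro B hB
    refine le_of_forall_pos_le_add fun ε hε => ?_
    obtain ⟨_, ⟨i, rfl⟩, hi⟩ := (hA (μ + ν) inferInstance).approx B hB (measure_ne_top _ _) ε hε
    have hAi := (hA (μ + ν) inferInstance).measurable (A i) ⟨i, rfl⟩
    have h1 : (μ + ν).real (symmDiff B (A i)) < ε := by
      rw [measureReal_def]
      exact (ENNReal.toReal_lt_toReal (measure_ne_top _ _) ENNReal.ofReal_ne_top).2 hi |>.trans_eq
        (ENNReal.toReal_ofReal hε.le)
    rw [measureReal_add_apply] at h1
    have h2 : μ.real B - μ.real (A i) ≤ μ.real (symmDiff B (A i)) :=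
      ((le_measureReal_sdiff).trans (measureReal_mono (by
        intro x hx; exact Or.inl hx)))
    have h3 : ν.real (A i) - ν.real B ≤ ν.real (symmDiff B (A i)) :=
      ((le_measureReal_sdiff).trans (measureReal_mono (by
        intro x hx; exact Or.inr hx)))
    have h4 : μ.real (A i) - ν.real (A i) ≤ (gap A μ ν).toReal := by
      refine (ENNReal.le_toReal_sub (measure_ne_top _ _)).trans ?_
      exact ENNReal.toReal_mono hfin (le_iSup (fun i => μ (A i) - ν (A i)) i)
    linarith
  have : Nonempty {B : Set Ω // MeasurableSet B} := ⟨⟨∅, .empty⟩⟩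
  -- The one-sided bound for the complement of `B` is the opposite bound for `B`.
  refine ciSup_le fun B => abs_le.2 ⟨?_, hone B B.2⟩
  have := hone _ B.2.compl
  rw [probReal_compl_eq_one_sub B.2, probReal_compl_eq_one_sub B.2] at this
  linarith

theorem tvDist_nonneg (μ ν : Measure Ω) : 0 ≤ tvDist μ ν :=
  Real.iSup_nonneg fun _ => abs_nonneg _

/-- A common part of two measures that dominate `π`. -/
theorem exists_common_part {π μ ν : Measure Ω} [IsProbabilityMeasure π] [IsProbabilityMeasure μ]
    [IsFiniteMeasure ν] (hμ : π ≪ μ) (hν : π ≪ ν) :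
    ∃ l : Measure Ω, l ≤ μ ∧ l ≤ ν ∧ l Set.univ ≠ 0 ∧ l Set.univ < 1 := by
  set l := π.withDensity fun x => min (μ.rnDeriv π x) (ν.rnDeriv π x) with hl
  have h1 : l ≤ μ := (withDensity_mono (ae_of_all _ fun x => min_le_left _ _)).trans
      (Measure.withDensity_rnDeriv_le μ π)
  have h2 : l ≤ ν := (withDensity_mono (ae_of_all _ fun x => min_le_right _ _)).trans
      (Measure.withDensity_rnDeriv_le ν π)
  have h3 : l Set.univ ≠ 0 := by
    intro h
    rw [hl, withDensity_apply _ .univ, Measure.restrict_univ, lintegral_eq_zero_iff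
      ((Measure.measurable_rnDeriv _ _).min (Measure.measurable_rnDeriv _ _))] at h
    have : ∀ᵐ x ∂π, False := by
      filter_upwards [h, Measure.rnDeriv_pos' hμ, Measure.rnDeriv_pos' hν] with x hx h1 h2
      exact (lt_min h1 h2).ne' hx
    exact IsProbabilityMeasure.ne_zero π (by simpa using this)
  -- Halving forces mass below `1`, so that `1 - l Set.univ` can later be cancelled.
  have hhalf : (2⁻¹ : ℝ≥0∞) • l ≤ l := by
    refine Measure.le_iff.2 fun s _ => ?_
    simp only [Measure.smul_apply, smul_eq_mul]
    exact mul_le_of_le_one_left' (by simp)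
  refine ⟨(2⁻¹ : ℝ≥0∞) • l, hhalf.trans h1, hhalf.trans h2, by simpa using h3, ?_⟩
  calc ((2⁻¹ : ℝ≥0∞) • l) Set.univ = 2⁻¹ * l Set.univ := rfl
    _ ≤ 2⁻¹ * 1 := by gcongr; exact (h1 _).trans prob_le_one
    _ < 1 := by rw [mul_one]; exact ENNReal.inv_lt_one.2 ENNReal.one_lt_two

/-- The common part `l` contributes equally to both integrals and cancels. The residuals have mass
`1 - l Set.univ`, their product the square of it: this is the gain of one factor used in
`limGap_ae_eq_zero`. -/
theorem lintegral_sub_lintegral_le_residual {μ ν l : Measure Ω} [IsProbabilityMeasure μ]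
    [IsProbabilityMeasure ν] (hμ : l ≤ μ) (hν : l ≤ ν) {h : Ω → ℝ≥0∞} (hh : Measurable h)
    (hb : ∀ x, h x ≤ 1) :
    (1 - l Set.univ) * (∫⁻ x, h x ∂μ - ∫⁻ x, h x ∂ν) ≤
      ∫⁻ q, (h q.1 - h q.2) ∂((μ - l).prod (ν - l)) := by
  have : IsFiniteMeasure l := isFiniteMeasure_of_le μ hμ
  have e1 : μ - l + l = μ := Measure.sub_add_cancel_of_le hμ
  have e2 : ν - l + l = ν := Measure.sub_add_cancel_of_le hν
  have m1 : (μ - l) Set.univ = 1 - l Set.univ := by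
    rw [Measure.sub_apply .univ hμ, measure_univ]
  have m2 : (ν - l) Set.univ = 1 - l Set.univ := by
    rw [Measure.sub_apply .univ hν, measure_univ]
  have hl : ∫⁻ x, h x ∂l ≠ ∞ := by
    refine ne_top_of_le_ne_top (measure_ne_top l Set.univ) ?_
    calc ∫⁻ x, h x ∂l ≤ ∫⁻ _, 1 ∂l := lintegral_mono hb
      _ = l Set.univ := by simp
  have e3 : ∫⁻ x, h x ∂μ - ∫⁻ x, h x ∂ν = ∫⁻ x, h x ∂(μ - l) - ∫⁻ x, h x ∂(ν - l) := by
    conv_lhs => rw [← e1, ← e2]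
    rw [lintegral_add_measure, lintegral_add_measure, ENNReal.add_sub_add_eq_sub_right hl]
  rw [e3, ← m1]
  exact lintegral_sub_lintegral_le_prod _ _ (m1.trans m2.symm) hh hh

/-! ### Invariant measures, subharmonic functions and convergence -/

theorem isMarkovKernel_pow (P : Kernel Ω Ω) [IsMarkovKernel P] (m : ℕ) :
    IsMarkovKernel (P ^ m) := by
  induction m with
  | zero => exact inferInstanceAs (IsMarkovKernel Kernel.id)
  | succ m ih => rw [pow_succ]; exact inferInstanceAs (IsMarkovKernel ((P ^ m) ∘ₖ P))

theorem invariant_pow {P : Kernel Ω Ω} {π : Measure Ω} (hP : P.Invariant π) (m : ℕ) :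
    (P ^ m).Invariant π := by
  induction m with
  | zero => exact Measure.id_comp
  | succ m ih => rw [pow_succ]; exact ih.comp hP

theorem lintegral_lintegral_of_invariant {P : Kernel Ω Ω} {π : Measure Ω} (hP : P.Invariant π)
    {f : Ω → ℝ≥0∞} (hf : Measurable f) : ∫⁻ x, ∫⁻ y, f y ∂(P x) ∂π = ∫⁻ x, f x ∂π := by
  conv_rhs => rw [← hP.def]
  exact (Measure.lintegral_bind P.aemeasurable hf.aemeasurable).symm

theorem ae_ae_of_invariant {P : Kernel Ω Ω} {π : Measure Ω} (hP : P.Invariant π) {p : Ω → Prop}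
    (hp : MeasurableSet {x | p x}) (h : ∀ᵐ x ∂π, p x) : ∀ᵐ x ∂π, ∀ᵐ y ∂(P x), p y := by
  have h0 : π {x | p x}ᶜ = 0 := h
  rw [← hP.def, Measure.bind_apply hp.compl P.aemeasurable,
    lintegral_eq_zero_iff (Kernel.measurable_coe _ hp.compl)] at h0
  exact h0

/-- The two coordinates can be moved one after the other, each move preserving its marginal. -/
theorem invariant_parallelComp {P : Kernel Ω Ω} [IsMarkovKernel P] {π : Measure Ω}
    [IsProbabilityMeasure π] (hP : P.Invariant π) : (P ∥ₖ P).Invariant (π.prod π) := by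
  have h : P ∥ₖ P = (P ∥ₖ Kernel.id) ∘ₖ (Kernel.id ∥ₖ P) := by
    rw [Kernel.parallelComp_comp_parallelComp, Kernel.comp_id, Kernel.id_comp]
  rw [Kernel.Invariant, h, ← Measure.comp_assoc, ← Measure.prod_comp_right, hP.def,
    ← Measure.prod_comp_left, hP.def]

/-- A bounded subharmonic function of an irreducible stationary chain is almost constant. -/
theorem null_or_null_of_subharmonic {P : Kernel Ω Ω} [IsMarkovKernel P] {π : Measure Ω}
    [IsProbabilityMeasure π] (hP : P.Invariant π) (hac : ∀ᵐ x ∂π, π ≪ P x) {F : Ω → ℝ≥0∞}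
    (hF : Measurable F) (hF1 : ∀ x, F x ≤ 1) (hsub : ∀ x, F x ≤ ∫⁻ y, F y ∂(P x)) (t : ℝ≥0∞) :
    (∀ᵐ x ∂π, t < F x) ∨ ∀ᵐ x ∂π, F x ≤ t := by
  by_contra! hcon
  obtain ⟨h1, h2⟩ := hcon
  have hG : Measurable fun x => F x - t := by fun_prop
  have hle : ∀ x, F x - t ≤ ∫⁻ y, (F y - t) ∂(P x) := fun x => by
    calc F x - t ≤ ∫⁻ y, F y ∂(P x) - ∫⁻ _, t ∂(P x) := by
          simpa using tsub_le_tsub_right (hsub x) t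
      _ ≤ _ := lintegral_sub_le _ _ (by fun_prop)
  have hfin : ∫⁻ x, (F x - t) ∂π ≠ ∞ := by
    refine ne_top_of_le_ne_top ENNReal.one_ne_top ?_
    calc ∫⁻ x, (F x - t) ∂π ≤ ∫⁻ _, 1 ∂π := lintegral_mono fun x => tsub_le_self.trans (hF1 x)
      _ = 1 := by simp
  -- The positive part `(F - t)⁺` is again subharmonic, and by invariance it has the same integral
  -- as its image under `P`; so the two agree almost everywhere. At a point where it is zero, it
  -- must then vanish `P x`-almost everywhere, hence `π`-almost everywhere.
  have heq := ae_eq_of_ae_le_of_lintegral_le (ae_of_all π hle) hfin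
    (hG.lintegral_kernel).aemeasurable (lintegral_lintegral_of_invariant hP hG).le
  obtain ⟨x, hx, hx1, hx2⟩ := (h1.and_eventually (heq.and hac)).exists
  replace hx := tsub_eq_zero_iff_le.2 hx
  simp only [hx] at hx1
  rw [eq_comm, lintegral_eq_zero_iff hG] at hx1
  refine h2 ?_
  filter_upwards [hx2.ae_le hx1] with y hy
  exact not_lt.2 (tsub_eq_zero_iff_le.1 hy)

theorem measurable_gap_pow {A : ℕ → Set Ω} (hA : ∀ i, MeasurableSet (A i)) (P : Kernel Ω Ω)
    (m : ℕ) : Measurable fun q : Ω × Ω => gap A ((P ^ m) q.1) ((P ^ m) q.2) :=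
  Measurable.iSup fun i => ((Kernel.measurable_coe _ (hA i)).comp measurable_fst).sub
    ((Kernel.measurable_coe _ (hA i)).comp measurable_snd)

theorem measurable_gap_pow_left {A : ℕ → Set Ω} (hA : ∀ i, MeasurableSet (A i)) (P : Kernel Ω Ω)
    (π : Measure Ω) (m : ℕ) : Measurable fun x : Ω => gap A ((P ^ m) x) π :=
  Measurable.iSup fun i => (Kernel.measurable_coe _ (hA i)).sub measurable_const

theorem gap_pow_succ_le {A : ℕ → Set Ω} (hA : ∀ i, MeasurableSet (A i)) (P : Kernel Ω Ω)
    [IsMarkovKernel P] {l : Measure Ω} {x y : Ω} (hx : l ≤ P x) (hy : l ≤ P y) (m : ℕ) :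
    (1 - l Set.univ) * gap A ((P ^ (m + 1)) x) ((P ^ (m + 1)) y) ≤
      ∫⁻ q, gap A ((P ^ m) q.1) ((P ^ m) q.2) ∂((P x - l).prod (P y - l)) := by
  have := isMarkovKernel_pow P m
  rw [gap, ENNReal.mul_iSup]
  refine iSup_le fun i => ?_
  rw [add_comm, Kernel.pow_add_apply_eq_lintegral _ _ _ _ (hA i), pow_one,
    Kernel.pow_add_apply_eq_lintegral _ _ _ _ (hA i), pow_one]
  refine (lintegral_sub_lintegral_le_residual hx hy (Kernel.measurable_coe _ (hA i))
    fun _ => prob_le_one).trans (lintegral_mono fun q => ?_)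
  exact le_iSup (fun i => (P ^ m) q.1 (A i) - (P ^ m) q.2 (A i)) i

/-- The asymptotic discrepancy of the chains started from two points. -/
noncomputable def limGap (A : ℕ → Set Ω) (P : Kernel Ω Ω) (q : Ω × Ω) : ℝ≥0∞ :=
  limsup (fun m => gap A ((P ^ m) q.1) ((P ^ m) q.2)) atTop

/-- Condition on the first step, cancel the common part `l`, and pass to the limit by the reverse
Fatou lemma, the discrepancies being bounded by `1`. -/
theorem limGap_le_residual {A : ℕ → Set Ω} (hA : ∀ i, MeasurableSet (A i)) (P : Kernel Ω Ω)
    [IsMarkovKernel P] {l : Measure Ω} {x y : Ω} (hx : l ≤ P x) (hy : l ≤ P y) :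
    (1 - l Set.univ) * limGap A P (x, y) ≤
      ∫⁻ q, limGap A P q ∂((P x - l).prod (P y - l)) := by
  rw [limGap, ← ENNReal.limsup_const_mul_of_ne_top (ENNReal.sub_ne_top ENNReal.one_ne_top),
    ← limsup_nat_add _ 1]
  refine (limsup_le_limsup (Eventually.of_forall fun m => gap_pow_succ_le hA P hx hy m)).trans ?_
  refine limsup_lintegral_le (fun _ => 1) (measurable_gap_pow hA P) (fun m => ?_) ?_
  · have := isMarkovKernel_pow P m
    exact ae_of_all _ fun q => gap_le_one _ _ _
  · simp only [lintegral_const, one_mul]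
    exact measure_ne_top _ _

theorem limGap_le_one (A : ℕ → Set Ω) (P : Kernel Ω Ω) [IsMarkovKernel P] (q : Ω × Ω) :
    limGap A P q ≤ 1 := by
  refine limsup_le_of_le (by isBoundedDefault) (Eventually.of_forall fun m => ?_)
  have := isMarkovKernel_pow P m
  exact gap_le_one _ _ _

theorem limGap_ae_eq_zero {A : ℕ → Set Ω} (hA : ∀ i, MeasurableSet (A i)) {P : Kernel Ω Ω}
    [IsMarkovKernel P] {π : Measure Ω} [IsProbabilityMeasure π] (hP : P.Invariant π)
    (hac : ∀ᵐ x ∂π, π ≪ P x) : ∀ᵐ q ∂(π.prod π), limGap A P q = 0 := by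
  set F := limGap A P
  have hF : Measurable F := Measurable.limsup (measurable_gap_pow hA P)
  have hac2 : ∀ᵐ q ∂(π.prod π), π ≪ P q.1 ∧ π ≪ P q.2 :=
    (Measure.quasiMeasurePreserving_fst.ae hac).and (Measure.quasiMeasurePreserving_snd.ae hac)
  -- With nothing cancelled, `l = 0`, the residual bound is subharmonicity for the pair of
  -- independent chains.
  have hsub : ∀ q, F q ≤ ∫⁻ r, F r ∂((P ∥ₖ P) q) := fun q => by
    simpa [Kernel.parallelComp_apply] using
      limGap_le_residual hA P (l := 0) (x := q.1) (y := q.2) (Measure.zero_le _)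
        (Measure.zero_le _)
  have hdich := null_or_null_of_subharmonic (invariant_parallelComp hP)
    (by filter_upwards [hac2] with q hq
        rw [Kernel.parallelComp_apply]
        exact hq.1.prod hq.2) hF (limGap_le_one A P) hsub
  set c := essSup F (π.prod π)
  have hle : ∀ᵐ q ∂(π.prod π), F q ≤ c := ENNReal.ae_le_essSup F
  suffices hc : c = 0 by
    filter_upwards [hle] with q hq
    exact le_antisymm (hc ▸ hq) zero_le
  by_contra hc
  have hc1 : c ≤ 1 := essSup_le_of_ae_le _ (ae_of_all _ (limGap_le_one A P))
  -- The residual product has mass `(1 - l Set.univ) ^ 2` and `F ≤ c` on it almost everywhere;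
  -- dividing by one factor leaves `F q ≤ c * (1 - l Set.univ)`.
  have hlt : ∀ᵐ q ∂(π.prod π), F q < c := by
    filter_upwards [hac2, ae_ae_of_invariant (invariant_parallelComp hP)
      (measurableSet_le hF measurable_const) hle] with q hq hqc
    obtain ⟨l, h1, h2, h3, h4⟩ := exists_common_part hq.1 hq.2
    have : IsFiniteMeasure l := isFiniteMeasure_of_le _ h1
    have hr := limGap_le_residual hA P h1 h2
    rw [Kernel.parallelComp_apply] at hqc
    have hac' : (P q.1 - l).prod (P q.2 - l) ≪ (P q.1).prod (P q.2) :=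
      (Measure.absolutelyContinuous_of_le Measure.sub_le).prod
        (Measure.absolutelyContinuous_of_le Measure.sub_le)
    have hr2 : ∫⁻ r, F r ∂((P q.1 - l).prod (P q.2 - l)) ≤
        (1 - l Set.univ) * (c * (1 - l Set.univ)) := by
      calc ∫⁻ r, F r ∂((P q.1 - l).prod (P q.2 - l))
          ≤ ∫⁻ _, c ∂((P q.1 - l).prod (P q.2 - l)) := lintegral_mono_ae (hac'.ae_le hqc)
        _ = (1 - l Set.univ) * (c * (1 - l Set.univ)) := by
          rw [lintegral_const, ← Set.univ_prod_univ, Measure.prod_prod,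
            Measure.sub_apply .univ h1, Measure.sub_apply .univ h2, measure_univ (μ := P q.1),
            measure_univ (μ := P q.2)]
          ring
    have hr3 : F q ≤ c * (1 - l Set.univ) :=
      (ENNReal.mul_le_mul_iff_right (tsub_pos_of_lt h4).ne'
        (ENNReal.sub_ne_top ENNReal.one_ne_top)).1 (hr.trans hr2)
    refine hr3.trans_lt ?_
    calc c * (1 - l Set.univ) < c * 1 := by
          refine (ENNReal.mul_lt_mul_iff_right hc (ne_top_of_le_ne_top ENNReal.one_ne_top hc1)).2 ?_
          exact ENNReal.sub_lt_self ENNReal.one_ne_top one_ne_zero h3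
      _ = c := mul_one c
  -- By the dichotomy, every level below the essential supremum is exceeded almost everywhere;
  -- rational levels keep this to countably many null sets.
  have hgt : ∀ᵐ q ∂(π.prod π), ∀ r : ℚ, ((Real.toNNReal r : ℝ≥0) : ℝ≥0∞) < c →
      ((Real.toNNReal r : ℝ≥0) : ℝ≥0∞) < F q := by
    refine ae_all_iff.2 fun r => ?_
    by_cases hrc : ((Real.toNNReal r : ℝ≥0) : ℝ≥0∞) < c
    · rcases hdich ((Real.toNNReal r : ℝ≥0) : ℝ≥0∞) with h | h
      · filter_upwards [h] with q hq _ using hq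
      · exact absurd (essSup_le_of_ae_le _ h) (not_le.2 hrc)
    · exact ae_of_all _ fun _ h => absurd h hrc
  obtain ⟨q, h1, h2⟩ := (hlt.and hgt).exists
  obtain ⟨r, _, hr1, hr2⟩ := ENNReal.lt_iff_exists_rat_btwn.1 h1
  exact lt_asymm hr1 (h2 r hr2)

/-- For a stationary chain all of whose one-step laws dominate the invariant distribution `π`, the
asymptotic distance to `π` is controlled by a bounded subharmonic function that vanishes almost
everywhere. -/
theorem exists_subharmonic_of_absolutelyContinuous [MeasurableSpace.CountablyGenerated Ω]
    {P : Kernel Ω Ω} [IsMarkovKernel P] {π : Measure Ω} [IsProbabilityMeasure π]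
    (hP : P.Invariant π) (hac : ∀ᵐ x ∂π, π ≪ P x) :
    ∃ h : Ω → ℝ≥0∞, Measurable h ∧ (∀ x, h x ≤ 1) ∧ (∀ x, h x ≤ ∫⁻ y, h y ∂(P x)) ∧
      (∀ᵐ x ∂π, h x = 0) ∧
      ∀ x, h x = 0 → Tendsto (fun m : ℕ => tvDist ((P ^ m) x) π) atTop (𝓝 0) := by
  obtain ⟨A, hA, hdense⟩ := exists_countable_measureDense_algebra (Ω := Ω)
  have hmk := isMarkovKernel_pow P
  have hT := measurable_gap_pow_left hA P π
  refine ⟨fun x => limsup (fun m => gap A ((P ^ m) x) π) atTop, Measurable.limsup hT, fun x => ?_,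
    fun x => ?_, ?_, fun x hx => ?_⟩
  · exact limsup_le_of_le (by isBoundedDefault) (Eventually.of_forall fun m => gap_le_one _ _ _)
  · change limsup (fun m => gap A ((P ^ m) x) π) atTop ≤ _
    rw [← limsup_nat_add _ 1]
    refine (limsup_le_limsup (Eventually.of_forall fun m => ?_)).trans
      (limsup_lintegral_le (fun _ => 1) hT (fun m => ae_of_all _ fun q => gap_le_one _ _ _)
        (by simp))
    refine iSup_le fun i => ?_
    rw [add_comm, Kernel.pow_add_apply_eq_lintegral _ _ _ _ (hA i), pow_one]
    calc ∫⁻ y, (P ^ m) y (A i) ∂(P x) - π (A i)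
        = ∫⁻ y, (P ^ m) y (A i) ∂(P x) - ∫⁻ _, π (A i) ∂(P x) := by simp
      _ ≤ ∫⁻ y, ((P ^ m) y (A i) - π (A i)) ∂(P x) := lintegral_sub_le _ _ (by fun_prop)
      _ ≤ _ := lintegral_mono fun y => le_iSup (fun i => (P ^ m) y (A i) - π (A i)) i
  -- Since `π` is the average of `P ^ m` started from `y ∼ π`, the discrepancy to `π` is at most the
  -- average over `y` of the discrepancy between the chains from `x` and `y`.
  · filter_upwards [Measure.ae_ae_of_ae_prod (limGap_ae_eq_zero hA hP hac)] with x hx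
    have hle : ∀ m, gap A ((P ^ m) x) π ≤ ∫⁻ y, gap A ((P ^ m) x) ((P ^ m) y) ∂π := fun m => by
      refine iSup_le fun i => ?_
      have e : π (A i) = ∫⁻ y, (P ^ m) y (A i) ∂π := by
        conv_lhs => rw [← (invariant_pow hP m).def]
        exact Measure.bind_apply (hA i) (P ^ m).aemeasurable
      calc (P ^ m) x (A i) - π (A i)
          = ∫⁻ _, (P ^ m) x (A i) ∂π - ∫⁻ y, (P ^ m) y (A i) ∂π := by rw [← e]; simp
        _ ≤ ∫⁻ y, ((P ^ m) x (A i) - (P ^ m) y (A i)) ∂π :=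
            lintegral_sub_le _ _ (Kernel.measurable_coe _ (hA i))
        _ ≤ _ := lintegral_mono fun y => le_iSup (fun i => (P ^ m) x (A i) - (P ^ m) y (A i)) i
    refine le_antisymm ?_ zero_le
    refine (limsup_le_limsup (Eventually.of_forall hle)).trans ?_
    refine (limsup_lintegral_le (fun _ => 1)
      (fun m => (measurable_gap_pow hA P m).comp measurable_prodMk_left)
      (fun m => ae_of_all _ fun q => gap_le_one _ _ _) (by simp)).trans ?_
    exact (lintegral_congr_ae (g := fun _ => 0) hx).trans lintegral_zero |>.le
  · have h0 : Tendsto (fun m => gap A ((P ^ m) x) π) atTop (𝓝 0) :=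
      tendsto_of_le_liminf_of_limsup_le zero_le hx.le
    have h1 := (ENNReal.tendsto_toReal ENNReal.zero_ne_top).comp h0
    exact squeeze_zero (fun m => tvDist_nonneg _ _) (fun m => tvDist_le_gap hdense _ _) h1

/-! ### Uniqueness of the invariant measure -/

theorem absolutelyContinuous_of_invariant {P : Kernel Ω Ω} {π μ : Measure Ω} {S : Set Ω}
    (hac : ∀ x ∈ S, π ≪ P x) (hS : μ Sᶜ = 0) (hμ0 : μ ≠ 0) (hμ : P.Invariant μ) : π ≪ μ := by
  refine Measure.AbsolutelyContinuous.mk fun B hB h0 => ?_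
  rw [← hμ.def, Measure.bind_apply hB P.aemeasurable,
    lintegral_eq_zero_iff (Kernel.measurable_coe _ hB)] at h0
  have hS' : ∀ᵐ x ∂μ, x ∈ S := hS
  have : (ae μ).NeBot := ae_neBot.2 hμ0
  obtain ⟨x, hx, hxS⟩ := (h0.and hS').exists
  exact hac x hxS hx

/-- On one side of a Hahn decomposition `μ ≤ π`; on the other the subtraction is exact. -/
theorem le_sub_add_self (μ π : Measure Ω) [IsFiniteMeasure μ] [IsFiniteMeasure π] :
    μ ≤ (μ - π) + π := by
  obtain ⟨s, hs⟩ := exists_isHahnDecomposition μ π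
  have hms := hs.measurableSet
  calc μ = μ.restrict s + μ.restrict sᶜ := (Measure.restrict_add_restrict_compl hms).symm
    _ ≤ ((μ - π) + π).restrict s + ((μ - π) + π).restrict sᶜ := by
      refine add_le_add ?_ ?_
      · exact hs.le_on.trans (Measure.restrict_mono le_rfl (Measure.le_add_left le_rfl))
      · rw [Measure.restrict_add, Measure.restrict_sub_eq_restrict_sub_restrict hms.compl,
          Measure.sub_add_cancel_of_le hs.ge_on_compl]
    _ = _ := Measure.restrict_add_restrict_compl hms

/-- Applying `P` to `μ ≤ (μ - π) + π` shows that `μ - π` is at most its image under `P`; both have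
the same finite mass, so they coincide. -/
theorem invariant_sub {P : Kernel Ω Ω} [IsMarkovKernel P] {μ π : Measure Ω} [IsFiniteMeasure μ]
    [IsFiniteMeasure π] (hμ : P.Invariant μ) (hπ : P.Invariant π) : P.Invariant (μ - π) := by
  have hle : μ - π ≤ (μ - π).bind P := by
    refine Measure.sub_le_of_le_add (Measure.le_iff.2 fun s hs => ?_)
    rw [Measure.add_apply, Measure.bind_apply hs P.aemeasurable]
    calc μ s = ∫⁻ x, P x s ∂μ := by
          rw [← Measure.bind_apply hs P.aemeasurable, hμ.def]
      _ ≤ ∫⁻ x, P x s ∂((μ - π) + π) := lintegral_mono' (le_sub_add_self μ π) le_rfl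
      _ = ∫⁻ x, P x s ∂(μ - π) + π s := by
          rw [lintegral_add_measure, ← Measure.bind_apply (m := π) hs P.aemeasurable, hπ.def]
  refine (Measure.eq_of_le_of_measure_univ_eq hle ?_).symm
  rw [Measure.bind_apply .univ P.aemeasurable]
  simp

/-- If neither `μ - π` nor `π - μ` vanished, both would be invariant and dominate `π`; being
mutually singular, they would make `π` singular to itself. -/
theorem invariant_unique {P : Kernel Ω Ω} [IsMarkovKernel P] {π : Measure Ω}
    [IsProbabilityMeasure π] {S : Set Ω} (hP : P.Invariant π) (hS : π Sᶜ = 0)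
    (hac : ∀ x ∈ S, π ≪ P x) {μ : Measure Ω} [IsProbabilityMeasure μ] (hμS : μ Sᶜ = 0)
    (hμ : P.Invariant μ) : μ = π := by
  by_cases h1 : μ - π = 0
  · refine Measure.eq_of_le_of_isProbabilityMeasure ?_
    simpa [h1] using le_sub_add_self μ π
  by_cases h2 : π - μ = 0
  · refine (Measure.eq_of_le_of_isProbabilityMeasure ?_).symm
    simpa [h2] using le_sub_add_self π μ
  have h3 := absolutelyContinuous_of_invariant hac
    (Measure.absolutelyContinuous_of_le Measure.sub_le hμS) h1 (invariant_sub hμ hP)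
  have h4 := absolutelyContinuous_of_invariant hac
    (Measure.absolutelyContinuous_of_le Measure.sub_le hS) h2 (invariant_sub hP hμ)
  have h5 : π ⟂ₘ π := (Measure.mutually_singular_measure_sub (μ := μ) (ν := π)).mono_ac h3 h4
  exact absurd ((Measure.MutuallySingular.self_iff π).1 h5) (IsProbabilityMeasure.ne_zero π)

end Chain

/-! ### Error regions -/

variable {n K : ℕ}

theorem strongRegion_subset_square (δ ε s : ℝ) :
    strongRegion δ ε s ⊆ Set.Icc (0 : ℝ) 1 ×ˢ Set.Icc (0 : ℝ) 1 :=
  fun _ h => h.1.1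

theorem measurableSet_strongRegion (δ ε s : ℝ) : MeasurableSet (strongRegion δ ε s) :=
  measurable_prodMk_left (x := (ε, s)) (measurableSet_strongRegion_prod δ)

theorem volume_strongRegion_ne_top (δ ε s : ℝ) : volume (strongRegion δ ε s) ≠ ∞ :=
  measure_ne_top_of_subset (strongRegion_subset_square δ ε s)
    (isCompact_Icc.prod isCompact_Icc).measure_ne_top

/-- The strong region contains a nonempty open subset of the open unit square. -/
theorem exists_isOpen_subset_strongRegion {δ ε s : ℝ} (hδ0 : 0 ≤ δ) (hδ1 : δ ≤ 1) (hε : 0 < ε)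
    (hs0 : 0 < s) (hs1 : s < 1) :
    ∃ O : Set (ℝ × ℝ), IsOpen O ∧ O.Nonempty ∧ O ⊆ strongRegion δ ε s ∧
      O ⊆ Set.Ioo (0 : ℝ) 1 ×ˢ Set.Ioo (0 : ℝ) 1 := by
  have hE1 : 1 < Real.exp (s * ε) := Real.one_lt_exp_iff.2 (by positivity)
  have hE2 : Real.exp (s * ε) < Real.exp ε := Real.exp_lt_exp.2 (by nlinarith)
  set E := Real.exp ε
  set E' := Real.exp (s * ε)
  -- All constraints of `R(ε, δ)` made strict, together with a strict violation of the first
  -- constraint of `R(sε, sδ)`.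
  refine ⟨{p | p ∈ Set.Ioo (0 : ℝ) 1 ×ˢ Set.Ioo (0 : ℝ) 1 ∧ 1 - δ < p.1 + E * p.2 ∧
    1 - δ < p.2 + E * p.1 ∧ p.2 + E * p.1 < E + δ ∧ p.1 + E * p.2 < E + δ ∧
    p.1 + E' * p.2 < 1 - s * δ}, ?_, ?_, ?_, fun _ h => h.1⟩
  · have hlt : ∀ f g : ℝ × ℝ → ℝ, Continuous f → Continuous g → IsOpen {p | f p < g p} :=
      fun f g hf hg => isOpen_lt hf hg
    exact (isOpen_Ioo.prod isOpen_Ioo).inter <|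
      (hlt (fun _ => 1 - δ) (fun p => p.1 + E * p.2) (by fun_prop) (by fun_prop)).inter <|
      (hlt (fun _ => 1 - δ) (fun p => p.2 + E * p.1) (by fun_prop) (by fun_prop)).inter <|
      (hlt (fun p => p.2 + E * p.1) (fun _ => E + δ) (by fun_prop) (by fun_prop)).inter <|
      (hlt (fun p => p.1 + E * p.2) (fun _ => E + δ) (by fun_prop) (by fun_prop)).inter <|
      hlt (fun p => p.1 + E' * p.2) (fun _ => 1 - s * δ) (by fun_prop) (by fun_prop)
  · have hsδ : s * δ < 1 := by nlinarith
    -- On the diagonal, `(t, t)` satisfies the lower constraints for `(ε, δ)` above the first ratio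
    -- and violates them for `(sε, sδ)` below the second; any `t` in between also has `t < 1 / 2`,
    -- which gives the upper constraints.
    have hlt : (1 - δ) / (1 + E) < (1 - s * δ) / (1 + E') := by
      rw [div_lt_div_iff₀ (by linarith) (by linarith)]
      have h1 : (1 - δ) * (1 + E') ≤ (1 - s * δ) * (1 + E') := by gcongr; nlinarith
      have h2 : (1 - s * δ) * (1 + E') < (1 - s * δ) * (1 + E) := by
        apply mul_lt_mul_of_pos_left <;> linarith
      linarith
    obtain ⟨t, ht1, ht2⟩ := exists_between hlt
    rw [div_lt_iff₀ (by linarith)] at ht1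
    rw [lt_div_iff₀ (by linarith)] at ht2
    have ht0 : 0 < t := by
      by_contra! h
      nlinarith
    have hsδ0 : 0 ≤ s * δ := by positivity
    have hth : t * 2 < 1 := by nlinarith
    refine ⟨(t, t), ⟨⟨ht0, by dsimp only; linarith⟩, ⟨ht0, by dsimp only; linarith⟩⟩, ?_⟩
    refine ⟨?_, ?_, ?_, ?_, ?_⟩ <;> dsimp only <;> nlinarith
  · rintro p ⟨⟨h1, h2⟩, h3, h4, h5, h6, h7⟩
    refine ⟨⟨⟨Set.Ioo_subset_Icc_self h1, Set.Ioo_subset_Icc_self h2⟩, h3.le, h4.le, h5.le,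
      h6.le⟩, fun h => ?_⟩
    exact absurd h.2.1 (not_le.2 h7)

/-! ### Sign and size of the factors of the joint density -/

theorem errorPrior_nonneg (δ : ℝ) (θ z : ℝ × ℝ) : 0 ≤ errorPrior δ θ z :=
  Set.indicator_nonneg (fun _ _ => by positivity) _

theorem errorPrior_eq_zero {δ : ℝ} {θ z : ℝ × ℝ}
    (hz : z ∉ Set.Icc (0 : ℝ) 1 ×ˢ Set.Icc (0 : ℝ) 1) : errorPrior δ θ z = 0 :=
  Set.indicator_of_notMem (fun h => hz (strongRegion_subset_square _ _ _ h)) _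

theorem binomPMF_nonneg {N x : ℕ} {p : ℝ} (hp : p ∈ Set.Icc (0 : ℝ) 1) : 0 ≤ binomPMF N p x := by
  have h1 := hp.1
  have h2 : 0 ≤ 1 - p := sub_nonneg.2 hp.2
  unfold binomPMF
  positivity

theorem binomPMF_le {N x : ℕ} {p : ℝ} (hp : p ∈ Set.Icc (0 : ℝ) 1) :
    binomPMF N p x ≤ N.choose x := by
  have h1 : p ^ x ≤ 1 := pow_le_one₀ hp.1 hp.2
  have h2 : (1 - p) ^ (N - x) ≤ 1 := pow_le_one₀ (sub_nonneg.2 hp.2) (by linarith [hp.1])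
  have h3 : 0 ≤ (1 - p) ^ (N - x) := pow_nonneg (sub_nonneg.2 hp.2) _
  unfold binomPMF
  rw [mul_assoc]
  exact mul_le_of_le_one_right (Nat.cast_nonneg _) (mul_le_one₀ h1 h3 h2)

theorem binomPMF_pos {N x : ℕ} {p : ℝ} (hx : x ≤ N) (hp : p ∈ Set.Ioo (0 : ℝ) 1) :
    0 < binomPMF N p x := by
  have h1 := hp.1
  have h2 : 0 < 1 - p := sub_pos.2 hp.2
  have h3 : 0 < (N.choose x : ℝ) := Nat.cast_pos.2 (Nat.choose_pos hx)
  unfold binomPMF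
  positivity

theorem Model.weight_nonneg (M : Model n) (i : Fin n) (θ z : ℝ × ℝ) : 0 ≤ M.weight i θ z := by
  by_cases hz : z ∈ Set.Icc (0 : ℝ) 1 ×ˢ Set.Icc (0 : ℝ) 1
  · exact mul_nonneg (errorPrior_nonneg _ _ _)
      (mul_nonneg (binomPMF_nonneg hz.1) (binomPMF_nonneg hz.2))
  · simp [Model.weight, errorPrior_eq_zero hz]

theorem Model.weight_pos (M : Model n) {i : Fin n} (hX : M.X i ≤ M.N0 i) (hY : M.Y i ≤ M.N1 i)
    {θ : ℝ × ℝ} {O : Set (ℝ × ℝ)} (hO : IsOpen O) (hOr : O ⊆ strongRegion M.δ θ.1 θ.2)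
    (hOs : O ⊆ Set.Ioo (0 : ℝ) 1 ×ˢ Set.Ioo (0 : ℝ) 1) {z : ℝ × ℝ} (hz : z ∈ O) :
    0 < M.weight i θ z := by
  refine mul_pos ?_ (mul_pos (binomPMF_pos hX (hOs hz).1) (binomPMF_pos hY (hOs hz).2))
  rw [errorPrior, Set.indicator_of_mem (hOr hz)]
  refine one_div_pos.2 (ENNReal.toReal_pos ?_ (volume_strongRegion_ne_top _ _ _))
  exact ((hO.measure_pos volume ⟨z, hz⟩).trans_le (measure_mono hOr)).ne'

theorem oneSidedNormalPDF_nonneg (σ2 : ℝ≥0) (ε : ℝ) : 0 ≤ oneSidedNormalPDF σ2 ε :=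
  Set.indicator_nonneg (fun _ _ => div_nonneg (gaussianPDFReal_nonneg _ _ _) measureReal_nonneg) _

theorem oneSidedNormalPDF_of_neg {σ2 : ℝ≥0} {ε : ℝ} (h : ε < 0) : oneSidedNormalPDF σ2 ε = 0 :=
  Set.indicator_of_notMem (not_le.2 h) _

theorem gaussianReal_real_Ici_pos {σ2 : ℝ≥0} (hσ : 0 < σ2) :
    0 < (gaussianReal 0 σ2).real (Set.Ici 0) := by
  refine ENNReal.toReal_pos (fun h => ?_) (measure_ne_top _ _)
  have := gaussianReal_absolutelyContinuous' 0 hσ.ne' h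
  simp at this

theorem oneSidedNormalPDF_pos {σ2 : ℝ≥0} (hσ : 0 < σ2) {ε : ℝ} (h : 0 ≤ ε) :
    0 < oneSidedNormalPDF σ2 ε := by
  rw [oneSidedNormalPDF, Set.indicator_of_mem (Set.mem_Ici.2 h)]
  exact div_pos (gaussianPDFReal_pos _ _ _ hσ.ne') (gaussianReal_real_Ici_pos hσ)

theorem lintegral_oneSidedNormalPDF_ne_top {σ2 : ℝ≥0} (hσ : 0 < σ2) :
    ∫⁻ ε, ENNReal.ofReal (oneSidedNormalPDF σ2 ε) ≠ ∞ := by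
  have hc := gaussianReal_real_Ici_pos hσ
  set c := (gaussianReal 0 σ2).real (Set.Ici 0)
  refine ne_top_of_le_ne_top (b := (∫⁻ ε, gaussianPDF 0 σ2 ε) * ENNReal.ofReal c⁻¹) ?_ ?_
  · rw [lintegral_gaussianPDF_eq_one 0 hσ.ne', one_mul]
    exact ENNReal.ofReal_ne_top
  · rw [← lintegral_mul_const _ (measurable_gaussianPDF _ _)]
    refine lintegral_mono fun ε => ?_
    rw [gaussianPDF, ← ENNReal.ofReal_mul (gaussianPDFReal_nonneg _ _ _), ← div_eq_mul_inv]
    exact ENNReal.ofReal_le_ofReal (Set.indicator_le_self' (fun _ _ =>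
      div_nonneg (gaussianPDFReal_nonneg _ _ _) hc.le) _)

theorem betaPDFReal_nonneg {a b : ℝ} (ha : 0 < a) (hb : 0 < b) (s : ℝ) :
    0 ≤ betaPDFReal a b s := by
  by_cases h : 0 < s ∧ s < 1
  · exact (betaPDFReal_pos h.1 h.2 ha hb).le
  · simp [betaPDFReal, h]

theorem Model.paramPrior_nonneg (M : Model n) (ha : 0 < M.a) (hb : 0 < M.b) (θ : ℝ × ℝ) :
    0 ≤ M.paramPrior θ :=
  mul_nonneg (oneSidedNormalPDF_nonneg _ _) (betaPDFReal_nonneg ha hb _)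

theorem Model.paramPrior_of_neg (M : Model n) {θ : ℝ × ℝ} (h : θ.1 < 0) : M.paramPrior θ = 0 := by
  simp [Model.paramPrior, oneSidedNormalPDF_of_neg h]

theorem Model.paramPrior_pos (M : Model n) (hσ : 0 < M.σ2) (ha : 0 < M.a) (hb : 0 < M.b)
    {θ : ℝ × ℝ} (h0 : 0 ≤ θ.1) (h1 : 0 < θ.2) (h2 : θ.2 < 1) : 0 < M.paramPrior θ :=
  mul_pos (oneSidedNormalPDF_pos hσ h0) (betaPDFReal_pos h1 h2 ha hb)

theorem Model.lintegral_paramPrior_ne_top (M : Model n) (hσ : 0 < M.σ2) (ha : 0 < M.a)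
    (hb : 0 < M.b) : ∫⁻ θ, ENNReal.ofReal (M.paramPrior θ) ≠ ∞ := by
  have h1 : Measurable (oneSidedNormalPDF M.σ2) :=
    ((measurable_gaussianPDFReal 0 M.σ2).div_const _).indicator measurableSet_Ici
  simp only [Model.paramPrior, ENNReal.ofReal_mul (oneSidedNormalPDF_nonneg _ _)]
  rw [Measure.volume_eq_prod, lintegral_prod_mul
    (f := fun ε => ENNReal.ofReal (oneSidedNormalPDF M.σ2 ε))
    (g := fun s => ENNReal.ofReal (betaPDFReal M.a M.b s)) (by fun_prop)
    (measurable_betaPDFReal M.a M.b).ennreal_ofReal.aemeasurable]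
  refine ENNReal.mul_ne_top (lintegral_oneSidedNormalPDF_ne_top hσ) ?_
  have := lintegral_betaPDF_eq_one ha hb
  simp only [betaPDF] at this
  rw [this]
  exact ENNReal.one_ne_top

/-- The product of the weights of the points `z j`. -/
noncomputable def Model.prodWeight (M : Model n) (θ : ℝ × ℝ) (z : Fin n → ℝ × ℝ) : ℝ≥0∞ :=
  ∏ j, ENNReal.ofReal (M.weight j θ (z j))

/-! ### The joint density: factorisation, measurability and total mass -/

theorem Model.prodWeight_ne_zero_iff (M : Model n) {θ : ℝ × ℝ} {z : Fin n → ℝ × ℝ} :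
    M.prodWeight θ z ≠ 0 ↔ ∀ j, 0 < M.weight j θ (z j) := by
  simp [Model.prodWeight, Finset.prod_eq_zero_iff]

theorem Model.ofReal_jointDensity (M : Model n) (ha : 0 < M.a) (hb : 0 < M.b) (x : State n) :
    ENNReal.ofReal (M.jointDensity x) =
      ENNReal.ofReal (M.paramPrior x.1) * M.prodWeight x.1 x.2 := by
  rw [Model.jointDensity, ENNReal.ofReal_mul (M.paramPrior_nonneg ha hb _), Model.prodWeight,
    ENNReal.ofReal_prod_of_nonneg fun j _ => M.weight_nonneg _ _ _]

theorem Model.jointDensity_pos_iff (M : Model n) (ha : 0 < M.a) (hb : 0 < M.b) (x : State n) :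
    0 < M.jointDensity x ↔ 0 < M.paramPrior x.1 ∧ ∀ j, 0 < M.weight j x.1 (x.2 j) := by
  rw [← M.prodWeight_ne_zero_iff, ← ENNReal.ofReal_pos, M.ofReal_jointDensity ha hb,
    pos_iff_ne_zero, mul_ne_zero_iff, ← pos_iff_ne_zero, ENNReal.ofReal_pos]

theorem Model.mem_stateSpace_iff (M : Model n) (ha : 0 < M.a) (hb : 0 < M.b) (x : State n) :
    x ∈ M.stateSpace ↔ 0 < x.1.1 ∧ 0 < M.paramPrior x.1 ∧ ∀ j, 0 < M.weight j x.1 (x.2 j) :=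
  and_congr_right fun _ => M.jointDensity_pos_iff ha hb x

@[fun_prop]
theorem Model.measurable_weight_comp {Ω : Type*} [MeasurableSpace Ω] (M : Model n) (j : Fin n)
    {θ z : Ω → ℝ × ℝ} (hθ : Measurable θ) (hz : Measurable z) :
    Measurable fun ω => M.weight j (θ ω) (z ω) :=
  Measurable.comp (g := fun q : (ℝ × ℝ) × (ℝ × ℝ) => M.weight j q.1 q.2)
    (f := fun ω => (θ ω, z ω)) (M.measurable_weight j) (hθ.prodMk hz)

@[fun_prop]
theorem Model.measurable_paramPrior_comp {Ω : Type*} [MeasurableSpace Ω] (M : Model n)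
    {θ : Ω → ℝ × ℝ} (hθ : Measurable θ) : Measurable fun ω => M.paramPrior (θ ω) :=
  M.measurable_paramPrior.comp hθ

@[fun_prop]
theorem Model.measurable_prodWeight {Ω : Type*} [MeasurableSpace Ω] (M : Model n)
    {θ : Ω → ℝ × ℝ} {z : Ω → Fin n → ℝ × ℝ} (hθ : Measurable θ) (hz : Measurable z) :
    Measurable fun ω => M.prodWeight (θ ω) (z ω) := by
  unfold Model.prodWeight
  fun_prop

@[fun_prop]
theorem Model.measurable_jointDensity (M : Model n) : Measurable M.jointDensity := by
  unfold Model.jointDensity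
  fun_prop

theorem Model.measurableSet_stateSpace (M : Model n) : MeasurableSet M.stateSpace :=
  MeasurableSet.inter (measurableSet_lt (f := fun _ : State n => (0 : ℝ)) (g := fun x => x.1.1)
    measurable_const (by fun_prop)) (measurableSet_lt measurable_const M.measurable_jointDensity)

/-- Each uniform density has mass at most `1`, and each binomial probability is at most its
coefficient. The bound is uniform in `θ`, so the posterior can be normalised although the area of
the region may tend to `0`. -/
theorem Model.lintegral_prodWeight_le (M : Model n) (θ : ℝ × ℝ) :
    ∫⁻ z, M.prodWeight θ z ≤
      ∏ j, ((M.N0 j).choose (M.X j) * (M.N1 j).choose (M.Y j) : ℝ≥0∞) := by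
  set R := strongRegion M.δ θ.1 θ.2
  set c := ENNReal.ofReal (1 / volume.real R)
  set C : ℝ≥0∞ := ∏ j, ((M.N0 j).choose (M.X j) * (M.N1 j).choose (M.Y j) : ℝ≥0∞)
  have hle : ∀ z, M.prodWeight θ z ≤ (Set.univ.pi fun _ : Fin n => R).indicator
      (fun _ => c ^ n * C) z := by
    intro z
    by_cases hz : z ∈ Set.univ.pi fun _ : Fin n => R
    · rw [Set.indicator_of_mem hz]
      calc M.prodWeight θ z
          ≤ ∏ j, (c * ((M.N0 j).choose (M.X j) * (M.N1 j).choose (M.Y j) : ℝ≥0∞)) := by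
            refine Finset.prod_le_prod' fun j _ => ?_
            have hzj : z j ∈ R := hz j trivial
            have hsq := strongRegion_subset_square _ _ _ hzj
            rw [Model.weight, ENNReal.ofReal_mul (errorPrior_nonneg _ _ _), errorPrior,
              Set.indicator_of_mem hzj, Model.lik, ENNReal.ofReal_mul (binomPMF_nonneg hsq.1)]
            refine mul_le_mul_right (mul_le_mul' ?_ ?_) _
            · exact ENNReal.ofReal_le_of_le_toReal (by simpa using binomPMF_le hsq.1)
            · exact ENNReal.ofReal_le_of_le_toReal (by simpa using binomPMF_le hsq.2)
        _ = c ^ n * C := by simp [Finset.prod_mul_distrib, C]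
    · rw [Set.indicator_of_notMem hz, nonpos_iff_eq_zero]
      by_contra h
      refine hz fun j _ => ?_
      have := (M.prodWeight_ne_zero_iff.1 h j).ne'
      by_contra hj
      exact this (by simp [Model.weight, errorPrior, R] at hj ⊢; simp [hj])
  -- Only an inequality: a region of area zero makes the product `0`.
  have hc : c * volume R ≤ 1 := by
    by_cases h0 : volume R = 0
    · simp [h0]
    have h1 : volume R ≠ ∞ := volume_strongRegion_ne_top _ _ _
    have h2 : 0 < volume.real R := ENNReal.toReal_pos h0 h1
    rw [← ENNReal.ofReal_toReal h1, ← ENNReal.ofReal_mul (by positivity)]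
    refine ENNReal.ofReal_le_one.2 (le_of_eq ?_)
    exact one_div_mul_cancel h2.ne'
  calc ∫⁻ z, M.prodWeight θ z
      ≤ ∫⁻ z, (Set.univ.pi fun _ : Fin n => R).indicator (fun _ => c ^ n * C) z :=
        lintegral_mono hle
    _ = c ^ n * C * volume (Set.univ.pi fun _ : Fin n => R) :=
        lintegral_indicator_const (.univ_pi fun _ => measurableSet_strongRegion _ _ _) _
    _ = (c * volume R) ^ n * C := by
        rw [volume_pi_pi]
        simp [mul_pow]
        ring
    _ ≤ 1 * C := by gcongr; exact pow_le_one' hc n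
    _ = C := one_mul C

theorem Model.lintegral_jointMeasure (M : Model n) (ha : 0 < M.a) (hb : 0 < M.b)
    {f : State n → ℝ≥0∞} (hf : Measurable f) :
    ∫⁻ x, f x ∂M.jointMeasure =
      ∫⁻ θ, ENNReal.ofReal (M.paramPrior θ) * ∫⁻ z, M.prodWeight θ z * f (θ, z) := by
  rw [Model.jointMeasure, lintegral_withDensity_eq_lintegral_mul _ (by fun_prop) hf,
    Measure.volume_eq_prod, lintegral_prod _ (by fun_prop)]
  refine lintegral_congr fun θ => ?_
  rw [← lintegral_const_mul _ (by fun_prop)]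
  refine lintegral_congr fun z => ?_
  rw [Pi.mul_apply, M.ofReal_jointDensity ha hb, mul_assoc]

theorem Model.jointMeasure_univ_ne_top (M : Model n) (hσ : 0 < M.σ2) (ha : 0 < M.a)
    (hb : 0 < M.b) : M.jointMeasure Set.univ ≠ ∞ := by
  rw [← lintegral_one, M.lintegral_jointMeasure ha hb measurable_const]
  simp only [mul_one]
  set C : ℝ≥0∞ := ∏ j, ((M.N0 j).choose (M.X j) * (M.N1 j).choose (M.Y j) : ℝ≥0∞)
  refine ne_top_of_le_ne_top (b := (∫⁻ θ, ENNReal.ofReal (M.paramPrior θ)) * C) ?_ ?_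
  · refine ENNReal.mul_ne_top (M.lintegral_paramPrior_ne_top hσ ha hb) ?_
    exact ENNReal.prod_ne_top fun j _ =>
      ENNReal.mul_ne_top (ENNReal.natCast_ne_top _) (ENNReal.natCast_ne_top _)
  · rw [← lintegral_mul_const _ (by fun_prop)]
    exact lintegral_mono fun θ => mul_le_mul_right (M.lintegral_prodWeight_le θ) _

theorem Model.jointMeasure_univ_ne_zero (M : Model n) (hδ0 : 0 ≤ M.δ) (hδ1 : M.δ ≤ 1)
    (hσ : 0 < M.σ2) (ha : 0 < M.a) (hb : 0 < M.b) (hX : ∀ i, M.X i ≤ M.N0 i)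
    (hY : ∀ i, M.Y i ≤ M.N1 i) : M.jointMeasure Set.univ ≠ 0 := by
  rw [← lintegral_one, M.lintegral_jointMeasure ha hb measurable_const]
  simp only [mul_one]
  intro h0
  rw [lintegral_eq_zero_iff (by fun_prop)] at h0
  have hpos : volume (Set.Ioi (0 : ℝ) ×ˢ Set.Ioo (0 : ℝ) 1) ≠ 0 :=
    ((isOpen_Ioi.prod isOpen_Ioo).measure_pos volume
      ⟨(1, 1 / 2), by constructor <;> norm_num⟩).ne'
  obtain ⟨θ, hθ, hθ0⟩ := ((frequently_ae_mem_iff.2 hpos).and_eventually h0).exists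
  have hPP := M.paramPrior_pos hσ ha hb (le_of_lt hθ.1) hθ.2.1 hθ.2.2
  have hW := (mul_eq_zero.1 hθ0).resolve_left (ENNReal.ofReal_pos.2 hPP).ne'
  rw [lintegral_eq_zero_iff (by fun_prop)] at hW
  obtain ⟨O, hO, ⟨t, ht⟩, hO1, hO2⟩ :=
    exists_isOpen_subset_strongRegion hδ0 hδ1 hθ.1 hθ.2.1 hθ.2.2
  have hOpos : volume (Set.univ.pi fun _ : Fin n => O) ≠ 0 :=
    ((isOpen_set_pi Set.finite_univ fun _ _ => hO).measure_pos volume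
      ⟨fun _ => t, fun _ _ => ht⟩).ne'
  obtain ⟨z, hz, hz0⟩ := ((frequently_ae_mem_iff.2 hOpos).and_eventually hW).exists
  exact M.prodWeight_ne_zero_iff.2
    (fun j => M.weight_pos (hX j) (hY j) hO hO1 hO2 (hz j trivial)) hz0

/-! ### Uniform points -/

instance : IsProbabilityMeasure unif :=
  ⟨by simp [unif]⟩

theorem unif_eq_restrict_Icc : unif = volume.restrict (Set.Icc 0 1) :=
  Measure.restrict_congr_set Ioo_ae_eq_Icc

/-- The uniform distribution on the unit square. -/
noncomputable abbrev squareLaw : Measure (ℝ × ℝ) := unif.prod unif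

/-- Independent uniform points of the unit square, indexed by `j`. -/
noncomputable abbrev pointsLaw (n : ℕ) : Measure (Fin n → ℝ × ℝ) := Measure.pi fun _ => squareLaw

/-- Independent uniform points of the unit square, indexed by `j` and `k`. -/
noncomputable abbrev gridLaw (n K : ℕ) : Measure (Fin n → Fin K → ℝ × ℝ) :=
  Measure.pi fun _ => Measure.pi fun _ => squareLaw

/-- The law of the fresh points. -/
noncomputable abbrev freshLaw (n K : ℕ) : Measure (Fin n → Fresh K → ℝ × ℝ) :=
  Measure.pi fun _ => Measure.pi fun _ => squareLaw

theorem pointsLaw_eq_restrict (n : ℕ) : pointsLaw n =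
    volume.restrict (Set.univ.pi fun _ : Fin n => Set.Icc (0 : ℝ) 1 ×ˢ Set.Icc (0 : ℝ) 1) := by
  rw [pointsLaw, squareLaw, unif_eq_restrict_Icc, Measure.prod_restrict, ← Measure.volume_eq_prod,
    volume_pi, Measure.restrict_pi_pi]

theorem mem_square_of_weight_pos (M : Model n) {j : Fin n} {θ z : ℝ × ℝ}
    (h : 0 < M.weight j θ z) : z ∈ Set.Icc (0 : ℝ) 1 ×ˢ Set.Icc (0 : ℝ) 1 := by
  by_contra hz
  simp [Model.weight, errorPrior_eq_zero hz] at h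

theorem measurableSet_cube (n : ℕ) : MeasurableSet
    (Set.univ.pi fun _ : Fin n => Set.Icc (0 : ℝ) 1 ×ˢ Set.Icc (0 : ℝ) 1) :=
  .univ_pi fun _ => measurableSet_Icc.prod measurableSet_Icc

/-- The weights vanish off the unit square, so Lebesgue measure may be replaced by the law of the
fresh points. This is what makes current and fresh points exchangeable up to the weight. -/
theorem Model.lintegral_prodWeight_mul (M : Model n) (θ : ℝ × ℝ) (f : (Fin n → ℝ × ℝ) → ℝ≥0∞) :
    ∫⁻ z, M.prodWeight θ z * f z = ∫⁻ z, M.prodWeight θ z * f z ∂(pointsLaw n) := by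
  rw [pointsLaw_eq_restrict, ← lintegral_indicator (measurableSet_cube n)]
  refine lintegral_congr fun z => ?_
  by_cases hz : z ∈ Set.univ.pi fun _ : Fin n => Set.Icc (0 : ℝ) 1 ×ˢ Set.Icc (0 : ℝ) 1
  · rw [Set.indicator_of_mem hz]
  · rw [Set.indicator_of_notMem hz, mul_eq_zero]
    left
    by_contra h
    exact hz fun j _ => mem_square_of_weight_pos M (M.prodWeight_ne_zero_iff.1 h j)

/-- The array of points made of the current points `z` and the fresh points. -/
def assemble (z : Fin n → ℝ × ℝ) (y : Fin n → Fresh K → ℝ × ℝ) (j : Fin n) (k : Fin K) : ℝ × ℝ :=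
  if h : (k : ℕ) = 0 then z j else y j ⟨k, h⟩

@[fun_prop]
theorem measurable_assemble {Ω : Type*} [MeasurableSpace Ω] {z : Ω → Fin n → ℝ × ℝ}
    {y : Ω → Fin n → Fresh K → ℝ × ℝ} (hz : Measurable z) (hy : Measurable y) :
    Measurable fun ω => assemble (z ω) (y ω) := by
  refine measurable_pi_lambda _ fun j => measurable_pi_lambda _ fun k => ?_
  unfold assemble
  split_ifs <;> fun_prop

theorem measurePreserving_cons (hK : 0 < K) {α : Type*} [MeasurableSpace α] (μ : Measure α)
    [IsProbabilityMeasure μ] :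
    MeasurePreserving (fun (q : α × (Fresh K → α)) (k : Fin K) =>
        if h : (k : ℕ) = 0 then q.1 else q.2 ⟨k, h⟩)
      (μ.prod (Measure.pi fun _ => μ)) (Measure.pi fun _ => μ) := by
  have hm : Measurable (fun (q : α × (Fresh K → α)) (k : Fin K) =>
        if h : (k : ℕ) = 0 then q.1 else q.2 ⟨k, h⟩) := by
    refine measurable_pi_lambda _ fun k => ?_
    split_ifs <;> fun_prop
  refine ⟨hm, (Measure.pi_eq fun s hs => ?_).symm⟩
  rw [Measure.map_apply hm (.univ_pi hs)]
  have hpre : (fun (q : α × (Fresh K → α)) (k : Fin K) =>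
        if h : (k : ℕ) = 0 then q.1 else q.2 ⟨k, h⟩) ⁻¹' Set.univ.pi s =
      s ⟨0, hK⟩ ×ˢ Set.univ.pi fun k : Fresh K => s k := by
    ext q
    simp only [Set.mem_preimage, Set.mem_pi, Set.mem_univ, true_implies, Set.mem_prod]
    constructor
    · intro h
      exact ⟨by simpa using h ⟨0, hK⟩, fun k => by simpa [k.2] using h k⟩
    · rintro ⟨h0, h1⟩ k
      split_ifs with hk
      · rwa [show k = ⟨0, hK⟩ from Fin.ext hk]
      · exact h1 ⟨k, hk⟩
  rw [hpre, Measure.prod_prod, Measure.pi_pi,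
    ← Fintype.prod_subtype_mul_prod_subtype (fun k : Fin K => (k : ℕ) = 0)
      (fun k => μ (s k))]
  congr 1
  have : Subsingleton {k : Fin K // (k : ℕ) = 0} :=
    ⟨fun a b => Subtype.ext (Fin.ext (a.2.trans b.2.symm))⟩
  exact (Fintype.prod_subsingleton (fun k : {k : Fin K // (k : ℕ) = 0} => μ (s k))
    ⟨⟨0, hK⟩, rfl⟩).symm

theorem measurePreserving_assemble (hK : 0 < K) :
    MeasurePreserving (fun q : (Fin n → ℝ × ℝ) × (Fin n → Fresh K → ℝ × ℝ) => assemble q.1 q.2)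
      ((pointsLaw n).prod (freshLaw n K)) (gridLaw n K) :=
  (measurePreserving_pi (fun _ : Fin n => squareLaw.prod (Measure.pi fun _ : Fresh K => squareLaw))
    (fun _ => Measure.pi fun _ : Fin K => squareLaw)
    (fun _ => measurePreserving_cons hK squareLaw)).comp
    (measurePreserving_arrowProdEquivProdArrow (ℝ × ℝ) (Fresh K → ℝ × ℝ) (Fin n)
      (fun _ => squareLaw) (fun _ => Measure.pi fun _ : Fresh K => squareLaw)).symm

theorem lintegral_assemble (hK : 0 < K) {f : (Fin n → Fin K → ℝ × ℝ) → ℝ≥0∞}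
    (hf : Measurable f) :
    ∫⁻ z, ∫⁻ y, f (assemble z y) ∂(freshLaw n K) ∂(pointsLaw n) = ∫⁻ p, f p ∂(gridLaw n K) := by
  rw [← (measurePreserving_assemble hK).lintegral_comp hf, lintegral_prod _ (by fun_prop)]

theorem measurePreserving_select {ι : Type*} [Fintype ι] (k : Fin n → ι) :
    MeasurePreserving (fun (p : Fin n → ι → ℝ × ℝ) j => p j (k j))
      (Measure.pi fun _ => Measure.pi fun _ => squareLaw) (pointsLaw n) :=
  measurePreserving_pi _ _ fun j => measurePreserving_eval (fun _ : ι => squareLaw) (k j)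

theorem measurePreserving_permute (σ : Fin n → Equiv.Perm (Fin K)) :
    MeasurePreserving (fun (p : Fin n → Fin K → ℝ × ℝ) j l => p j (σ j l))
      (gridLaw n K) (gridLaw n K) := by
  refine measurePreserving_pi _ _ (f := fun j (q : Fin K → ℝ × ℝ) l => q (σ j l)) fun j => ?_
  have hm : Measurable fun (q : Fin K → ℝ × ℝ) l => q (σ j l) := by fun_prop
  refine ⟨hm, (Measure.pi_eq fun s hs => ?_).symm⟩
  rw [Measure.map_apply hm (.univ_pi hs)]
  have hpre : (fun (q : Fin K → ℝ × ℝ) l => q (σ j l)) ⁻¹' Set.univ.pi s =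
      Set.univ.pi fun l => s ((σ j).symm l) := by
    ext q
    simp only [Set.mem_preimage, Set.mem_pi, Set.mem_univ, true_implies]
    exact ⟨fun h l => by simpa using h ((σ j).symm l), fun h l => by simpa using h (σ j l)⟩
  rw [hpre, Measure.pi_pi]
  exact Equiv.prod_comp (σ j).symm fun l => squareLaw (s l)

/-! ### One iteration -/

/-- The acceptance probability as a function of the array of points. -/
noncomputable def Model.accept (M : Model n) (θ θ' : ℝ × ℝ) (p : Fin n → Fin K → ℝ × ℝ) : ℝ :=
  min 1 ((M.paramPrior θ' * θ'.1) / (M.paramPrior θ * θ.1) *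
    ∏ j, (∑ k, M.weight j θ' (p j k)) / (∑ k, M.weight j θ (p j k)))

/-- The probability of selecting the points with indices `k j`. -/
noncomputable def Model.selectWeight (M : Model n) (θ : ℝ × ℝ) (p : Fin n → Fin K → ℝ × ℝ)
    (k : Fin n → Fin K) : ℝ≥0∞ :=
  ∏ j, ENNReal.ofReal (selectProb (fun l => M.weight j θ (p j l)) (k j))

/-- The mean of `f` after the selection step. -/
noncomputable def Model.selectMean (M : Model n) (f : State n → ℝ≥0∞) (θ : ℝ × ℝ)
    (p : Fin n → Fin K → ℝ × ℝ) : ℝ≥0∞ :=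
  ∑ k : Fin n → Fin K, M.selectWeight θ p k * f (θ, fun j => p j (k j))

section Measurability

variable {Ω : Type*} [MeasurableSpace Ω] {θ θ' : Ω → ℝ × ℝ} {p : Ω → Fin n → Fin K → ℝ × ℝ}

@[fun_prop]
theorem Model.measurable_accept (M : Model n) (hθ : Measurable θ) (hθ' : Measurable θ')
    (hp : Measurable p) : Measurable fun ω => M.accept (θ ω) (θ' ω) (p ω) := by
  unfold Model.accept
  fun_prop

@[fun_prop]
theorem Model.measurable_selectWeight (M : Model n) (hθ : Measurable θ) (hp : Measurable p)
    (k : Fin n → Fin K) : Measurable fun ω => M.selectWeight (θ ω) (p ω) k := by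
  unfold Model.selectWeight
  refine Finset.measurable_prod _ fun j _ => ENNReal.measurable_ofReal.comp ?_
  exact (measurable_selectProb (k j)).comp (measurable_pi_lambda _ fun l => by fun_prop)

@[fun_prop]
theorem Model.measurable_selectMean (M : Model n) {f : State n → ℝ≥0∞} (hf : Measurable f)
    (hθ : Measurable θ) (hp : Measurable p) :
    Measurable fun ω => M.selectMean f (θ ω) (p ω) := by
  unfold Model.selectMean
  fun_prop

end Measurability

theorem Model.lintegral_resampleLaw (M : Model n) (x : State n) (d : Draw n K)
    {f : State n → ℝ≥0∞} (hf : Measurable f) :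
    ∫⁻ y, f y ∂(M.resampleLaw x d) = M.selectMean f (M.newParam x d) (points x d) := by
  rw [Model.resampleLaw, lintegral_map hf (measurable_of_finite _), lintegral_fintype]
  refine Finset.sum_congr rfl fun k _ => ?_
  rw [Measure.pi_singleton, mul_comm]
  simp only [selectLaw_singleton]
  rfl

/-- No lower bound on `a` is required: for `a < 0` the event is null and `ENNReal.ofReal a = 0`. -/
theorem lintegral_unif_ite {a : ℝ} (ha : a ≤ 1) (x y : ℝ≥0∞) :
    ∫⁻ u, (if u ≤ a then x else y) ∂unif =
      ENNReal.ofReal a * x + (1 - ENNReal.ofReal a) * y := by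
  have hset : MeasurableSet {u : ℝ | u ≤ a} := measurableSet_Iic
  have h1 : unif {u : ℝ | u ≤ a} = ENNReal.ofReal a := by
    rw [unif_eq_restrict_Icc, Measure.restrict_apply hset]
    have : {u : ℝ | u ≤ a} ∩ Set.Icc 0 1 = Set.Icc 0 a := by
      ext u
      simp only [Set.mem_inter_iff, Set.mem_ofPred_eq, Set.mem_Icc]
      constructor
      · rintro ⟨h1, h2, h3⟩; exact ⟨h2, h1⟩
      · rintro ⟨h1, h2⟩; exact ⟨h2, h1, h2.trans ha⟩
    rw [this, Real.volume_Icc, sub_zero]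
  rw [← lintegral_add_compl _ hset,
    setLIntegral_congr_fun (f := fun u => if u ≤ a then x else y) (g := fun _ => x) hset
      fun u hu => if_pos hu,
    setLIntegral_congr_fun (f := fun u => if u ≤ a then x else y) (g := fun _ => y) hset.compl
      fun u hu => if_neg hu,
    setLIntegral_const, setLIntegral_const, prob_compl_eq_one_sub hset, h1, mul_comm x,
    mul_comm y]

instance (v : ℝ≥0) : IsMarkovKernel (gaussianKernel v) :=
  ⟨fun m => inferInstanceAs (IsProbabilityMeasure (gaussianReal m v))⟩

instance (vε vs : ℝ≥0) : IsMarkovKernel (proposal vε vs) := by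
  have := Kernel.IsMarkovKernel.map (gaussianKernel vε) Real.measurable_exp
  unfold proposal
  infer_instance

instance (vε vs : ℝ≥0) : IsMarkovKernel (draws n K vε vs) := by
  unfold draws
  infer_instance

theorem selectProb_nonneg {w : Fin K → ℝ} (hw : ∀ l, 0 ≤ w l) (k : Fin K) : 0 ≤ selectProb w k := by
  unfold selectProb
  split_ifs
  · positivity
  · exact div_nonneg (hw k) (Finset.sum_nonneg fun l _ => hw l)

theorem sum_selectProb (hK : 0 < K) (w : Fin K → ℝ) : ∑ k, selectProb w k = 1 := by
  unfold selectProb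
  split_ifs with h
  · simp [hK.ne']
  · rw [← Finset.sum_div, div_self h]

theorem isProbabilityMeasure_selectLaw (hK : 0 < K) {w : Fin K → ℝ} (hw : ∀ l, 0 ≤ w l) :
    IsProbabilityMeasure (selectLaw w) := by
  refine ⟨?_⟩
  simp only [selectLaw, Measure.finsetSum_apply, Measure.smul_apply, smul_eq_mul, measure_univ,
    mul_one]
  rw [← ENNReal.ofReal_sum_of_nonneg fun k _ => selectProb_nonneg hw k, sum_selectProb hK,
    ENNReal.ofReal_one]

theorem Model.isMarkovKernel_mcmcKernel (M : Model n) (hK : 0 < K) (vε vs : ℝ≥0) :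
    IsMarkovKernel (M.mcmcKernel K vε vs) := by
  have : IsMarkovKernel (M.resample K) := by
    refine ⟨fun p => ?_⟩
    have : ∀ j, IsProbabilityMeasure (selectLaw (M.newWeight p.1 p.2 j)) := fun j =>
      isProbabilityMeasure_selectLaw hK fun l => M.weight_nonneg _ _ _
    exact Measure.isProbabilityMeasure_map (measurable_of_finite _).aemeasurable
  unfold Model.mcmcKernel
  infer_instance

/-- The uniform variable `u` and the selected indices are integrated out, leaving the proposal and
the fresh points. -/
theorem Model.lintegral_mcmcKernel (M : Model n) (vε vs : ℝ≥0) (x : State n)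
    {f : State n → ℝ≥0∞} (hf : Measurable f) :
    ∫⁻ y, f y ∂(M.mcmcKernel K vε vs x) =
      ∫⁻ θ', ∫⁻ y, (ENNReal.ofReal (M.accept x.1 θ' (assemble x.2 y)) *
          M.selectMean f θ' (assemble x.2 y) +
        (1 - ENNReal.ofReal (M.accept x.1 θ' (assemble x.2 y))) *
          M.selectMean f x.1 (assemble x.2 y)) ∂(freshLaw n K) ∂(proposal vε vs x.1) := by
  have hm : Measurable fun d : Draw n K => M.selectMean f (M.newParam x d) (points x d) :=
    M.measurable_selectMean hf (M.measurable_newParam.comp measurable_prodMk_left)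
      (measurable_assemble (z := fun _ : Draw n K => x.2) (y := fun d => d.2.1) (by fun_prop)
        (by fun_prop))
  rw [Model.mcmcKernel, Kernel.lintegral_comp _ _ _ hf, Kernel.lintegral_id_prod
    (hf.lintegral_kernel)]
  have h1 : ∀ d, ∫⁻ y, f y ∂(M.resample K (x, d)) =
      M.selectMean f (M.newParam x d) (points x d) := fun d => M.lintegral_resampleLaw x d hf
  simp only [h1]
  rw [draws, Kernel.prod_apply, Kernel.comap_apply, Kernel.const_apply,
    lintegral_prod _ hm.aemeasurable]
  refine lintegral_congr fun θ' => ?_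
  have hm' : Measurable fun q : (Fin n → Fresh K → ℝ × ℝ) × ℝ =>
      M.selectMean f (M.newParam x (θ', q)) (points x (θ', q)) := hm.comp measurable_prodMk_left
  rw [lintegral_prod _ hm'.aemeasurable]
  refine lintegral_congr fun y => ?_
  have hacc : M.accept x.1 θ' (assemble x.2 y) ≤ 1 := min_le_left _ _
  rw [← lintegral_unif_ite hacc]
  refine lintegral_congr fun u => ?_
  change M.selectMean f (if u ≤ M.accept x.1 θ' (assemble x.2 y) then θ' else x.1)
    (assemble x.2 y) = _
  split_ifs <;> rfl

/-! ### Exchangeability of the points -/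

/-- Invariance under permutations of the points within each group. -/
def Exchangeable {α : Type*} (G : (Fin n → Fin K → ℝ × ℝ) → α) : Prop :=
  ∀ (σ : Fin n → Equiv.Perm (Fin K)) p, G (fun j l => p j (σ j l)) = G p

theorem Model.exchangeable_accept (M : Model n) (θ θ' : ℝ × ℝ) :
    Exchangeable (K := K) (M.accept θ θ') := by
  intro σ p
  have h : ∀ θ j, ∑ k, M.weight j θ (p j (σ j k)) = ∑ k, M.weight j θ (p j k) := fun θ j =>
    Equiv.sum_comp (σ j) fun k => M.weight j θ (p j k)
  simp only [Model.accept, h]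

theorem selectProb_permute (w : Fin K → ℝ) (σ : Equiv.Perm (Fin K)) (k : Fin K) :
    selectProb (fun l => w (σ l)) k = selectProb w (σ k) := by
  simp only [selectProb, Equiv.sum_comp σ w]

theorem Model.exchangeable_selectMean (M : Model n) (f : State n → ℝ≥0∞) (θ : ℝ × ℝ) :
    Exchangeable (K := K) (M.selectMean f θ) := by
  intro σ p
  unfold Model.selectMean
  rw [← Equiv.sum_comp (Equiv.piCongrRight σ)
    fun k => M.selectWeight θ p k * f (θ, fun j => p j (k j))]
  refine Finset.sum_congr rfl fun k _ => ?_
  congr 1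
  refine Finset.prod_congr rfl fun j _ => ?_
  rw [selectProb_permute (fun l => M.weight j θ (p j l))]
  rfl

/-- Swapping `i` and `k j` within each group preserves both the law of the array and `G`, so all `K
^ n` terms agree. -/
theorem lintegral_sum_select_mul (i : Fin K) {H : (Fin n → ℝ × ℝ) → ℝ≥0∞} (hH : Measurable H)
    {G : (Fin n → Fin K → ℝ × ℝ) → ℝ≥0∞} (hG : Measurable G) (hGs : Exchangeable G) :
    ∫⁻ p, (∑ k : Fin n → Fin K, H fun j => p j (k j)) * G p ∂(gridLaw n K) =
      (K : ℝ≥0∞) ^ n * ∫⁻ p, H (fun j => p j i) * G p ∂(gridLaw n K) := by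
  have hterm : ∀ k : Fin n → Fin K, ∫⁻ p, H (fun j => p j (k j)) * G p ∂(gridLaw n K) =
      ∫⁻ p, H (fun j => p j i) * G p ∂(gridLaw n K) := by
    intro k
    rw [← (measurePreserving_permute fun j => Equiv.swap i (k j)).lintegral_comp
      (f := fun p => H (fun j => p j i) * G p) (by fun_prop)]
    refine lintegral_congr fun p => ?_
    simp only [Equiv.swap_apply_left, hGs _ p]
  simp only [Finset.sum_mul]
  rw [lintegral_finsetSum _ fun k _ => by fun_prop, Finset.sum_congr rfl fun k _ => hterm k]
  simp

/-- The product over the groups of the total weights of the points. -/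
noncomputable def Model.totalWeight (M : Model n) (θ : ℝ × ℝ) (p : Fin n → Fin K → ℝ × ℝ) :
    ℝ≥0∞ :=
  ∏ j, ∑ k, ENNReal.ofReal (M.weight j θ (p j k))

theorem Model.totalWeight_eq_sum (M : Model n) (θ : ℝ × ℝ) (p : Fin n → Fin K → ℝ × ℝ) :
    M.totalWeight θ p = ∑ k : Fin n → Fin K, M.prodWeight θ fun j => p j (k j) := by
  rw [Model.totalWeight, Finset.prod_univ_sum, Fintype.piFinset_univ]
  rfl

@[fun_prop]
theorem Model.measurable_totalWeight {Ω : Type*} [MeasurableSpace Ω] (M : Model n)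
    {θ : Ω → ℝ × ℝ} {p : Ω → Fin n → Fin K → ℝ × ℝ} (hθ : Measurable θ) (hp : Measurable p) :
    Measurable fun ω => M.totalWeight (θ ω) (p ω) := by
  unfold Model.totalWeight
  fun_prop

theorem sum_mul_selectProb {w : Fin K → ℝ} (hw : ∀ l, 0 ≤ w l) (k : Fin K) :
    (∑ l, w l) * selectProb w k = w k := by
  unfold selectProb
  split_ifs with h
  -- The uniform convention for a zero total is harmless: every weight is then zero too.
  · rw [h, zero_mul, (Finset.sum_eq_zero_iff_of_nonneg fun l _ => hw l).1 h k (Finset.mem_univ k)]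
  · exact mul_div_cancel₀ _ h

/-- The selection probability is the conditional law of the position of the current points given the
array. -/
theorem Model.totalWeight_mul_selectWeight (M : Model n) (θ : ℝ × ℝ)
    (p : Fin n → Fin K → ℝ × ℝ) (k : Fin n → Fin K) :
    M.totalWeight θ p * M.selectWeight θ p k = M.prodWeight θ fun j => p j (k j) := by
  rw [Model.totalWeight, Model.selectWeight, ← Finset.prod_mul_distrib]
  refine Finset.prod_congr rfl fun j _ => ?_
  rw [← ENNReal.ofReal_sum_of_nonneg fun l _ => M.weight_nonneg _ _ _,
    ← ENNReal.ofReal_mul (Finset.sum_nonneg fun l _ => M.weight_nonneg _ _ _),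
    sum_mul_selectProb fun l => M.weight_nonneg _ _ _]

theorem Model.totalWeight_mul_selectMean (M : Model n) (f : State n → ℝ≥0∞) (θ : ℝ × ℝ)
    (p : Fin n → Fin K → ℝ × ℝ) :
    M.totalWeight θ p * M.selectMean f θ p =
      ∑ k : Fin n → Fin K, M.prodWeight θ (fun j => p j (k j)) * f (θ, fun j => p j (k j)) := by
  rw [Model.selectMean, Finset.mul_sum]
  refine Finset.sum_congr rfl fun k _ => ?_
  rw [← mul_assoc, M.totalWeight_mul_selectWeight]

theorem Model.lintegral_totalWeight_mul (M : Model n) (i : Fin K) (θ : ℝ × ℝ)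
    {G : (Fin n → Fin K → ℝ × ℝ) → ℝ≥0∞} (hG : Measurable G) (hGs : Exchangeable G) :
    ∫⁻ p, M.totalWeight θ p * G p ∂(gridLaw n K) =
      (K : ℝ≥0∞) ^ n * ∫⁻ p, M.prodWeight θ (fun j => p j i) * G p ∂(gridLaw n K) := by
  simp only [M.totalWeight_eq_sum]
  exact lintegral_sum_select_mul i (H := M.prodWeight θ) (by fun_prop) hG hGs

theorem Model.lintegral_totalWeight_mul_selectMean (M : Model n) (i : Fin K) (θ : ℝ × ℝ)
    {f : State n → ℝ≥0∞} (hf : Measurable f) {G : (Fin n → Fin K → ℝ × ℝ) → ℝ≥0∞}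
    (hG : Measurable G) (hGs : Exchangeable G) :
    ∫⁻ p, M.totalWeight θ p * (G p * M.selectMean f θ p) ∂(gridLaw n K) =
      (K : ℝ≥0∞) ^ n *
        ∫⁻ p, M.prodWeight θ (fun j => p j i) * (G p * f (θ, fun j => p j i)) ∂(gridLaw n K) := by
  have h1 : ∀ p : Fin n → Fin K → ℝ × ℝ, M.totalWeight θ p * (G p * M.selectMean f θ p) =
      (∑ k : Fin n → Fin K, M.prodWeight θ (fun j => p j (k j)) * f (θ, fun j => p j (k j))) *
        G p := fun p => by
    rw [← M.totalWeight_mul_selectMean]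
    ring
  simp only [h1]
  rw [lintegral_sum_select_mul i (H := fun z => M.prodWeight θ z * f (θ, z)) (by fun_prop) hG hGs]
  congr 1
  refine lintegral_congr fun p => ?_
  ring

/-- Selecting among exchangeable points according to their weights does not change the law of the
current points. -/
theorem Model.lintegral_prodWeight_mul_selectMean (M : Model n) (i : Fin K) (θ : ℝ × ℝ)
    {f : State n → ℝ≥0∞} (hf : Measurable f) {G : (Fin n → Fin K → ℝ × ℝ) → ℝ≥0∞}
    (hG : Measurable G) (hGs : Exchangeable G) :
    ∫⁻ p, M.prodWeight θ (fun j => p j i) * (G p * M.selectMean f θ p) ∂(gridLaw n K) =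
      ∫⁻ p, M.prodWeight θ (fun j => p j i) * (G p * f (θ, fun j => p j i)) ∂(gridLaw n K) := by
  have hK : (K : ℝ≥0∞) ^ n ≠ 0 := pow_ne_zero _ (by simpa using (Fin.pos i).ne')
  have hK' : (K : ℝ≥0∞) ^ n ≠ ∞ := ENNReal.pow_ne_top (ENNReal.natCast_ne_top _)
  refine (ENNReal.mul_right_inj hK hK').1 ?_
  -- Scaled by `K ^ n`, both sides symmetrise to the integral of `totalWeight * (G * selectMean)`.
  rw [← M.lintegral_totalWeight_mul_selectMean i θ hf hG hGs,
    ← M.lintegral_totalWeight_mul i θ (by fun_prop)]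
  intro σ p
  dsimp only
  rw [hGs σ p, M.exchangeable_selectMean f θ σ p]

/-! ### Logarithmic coordinates -/

/-- The parameter `(ε, s)` with logarithmic coordinates `τ = (log ε, s)`. -/
noncomputable def ofLog (τ : ℝ × ℝ) : ℝ × ℝ := (Real.exp τ.1, τ.2)

@[fun_prop]
theorem measurable_ofLog {Ω : Type*} [MeasurableSpace Ω] {τ : Ω → ℝ × ℝ} (hτ : Measurable τ) :
    Measurable fun ω => ofLog (τ ω) := by
  unfold ofLog
  fun_prop

theorem ofLog_fst_pos (τ : ℝ × ℝ) : 0 < (ofLog τ).1 := Real.exp_pos _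

theorem ofLog_log {θ : ℝ × ℝ} (h : 0 < θ.1) : ofLog (Real.log θ.1, θ.2) = θ :=
  Prod.ext (Real.exp_log h) rfl

theorem lintegral_ofLog {f : ℝ × ℝ → ℝ≥0∞} (hf : Measurable f) :
    ∫⁻ θ in Set.Ioi (0 : ℝ) ×ˢ Set.univ, f θ =
      ∫⁻ τ : ℝ × ℝ, ENNReal.ofReal (Real.exp τ.1) * f (ofLog τ) := by
  rw [Measure.volume_eq_prod, ← Measure.prod_restrict, Measure.restrict_univ,
    lintegral_prod _ hf.aemeasurable, lintegral_prod _ (by fun_prop)]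
  have himg : Set.Ioi (0 : ℝ) = Real.exp '' Set.univ := by
    rw [Set.image_univ, Real.range_exp]
  rw [himg, lintegral_image_eq_lintegral_abs_deriv_mul .univ
    (fun x _ => (Real.hasDerivAt_exp x).hasDerivWithinAt) Real.exp_injective.injOn,
    Measure.restrict_univ]
  refine lintegral_congr fun t => ?_
  rw [abs_of_pos (Real.exp_pos t)]
  exact (lintegral_const_mul _ (by fun_prop)).symm

/-- The density of the Gaussian random walk proposal in logarithmic coordinates. -/
noncomputable def stepDensity (vε vs : ℝ≥0) (τ τ' : ℝ × ℝ) : ℝ≥0∞ :=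
  gaussianPDF τ.1 vε τ'.1 * gaussianPDF τ.2 vs τ'.2

theorem gaussianPDF_comm (x y : ℝ) (v : ℝ≥0) : gaussianPDF x v y = gaussianPDF y v x := by
  simp only [gaussianPDF, gaussianPDFReal]
  rw [show (y - x) ^ 2 = (x - y) ^ 2 by ring]

theorem stepDensity_comm (vε vs : ℝ≥0) (τ τ' : ℝ × ℝ) :
    stepDensity vε vs τ τ' = stepDensity vε vs τ' τ := by
  rw [stepDensity, stepDensity, gaussianPDF_comm τ.1, gaussianPDF_comm τ.2]

@[fun_prop]
theorem measurable_stepDensity {Ω : Type*} [MeasurableSpace Ω] (vε vs : ℝ≥0)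
    {τ τ' : Ω → ℝ × ℝ} (hτ : Measurable τ) (hτ' : Measurable τ') :
    Measurable fun ω => stepDensity vε vs (τ ω) (τ' ω) := by
  unfold stepDensity gaussianPDF gaussianPDFReal
  fun_prop

theorem stepDensity_ne_zero {vε vs : ℝ≥0} (hvε : 0 < vε) (hvs : 0 < vs) (τ τ' : ℝ × ℝ) :
    stepDensity vε vs τ τ' ≠ 0 :=
  mul_ne_zero (gaussianPDF_pos _ hvε.ne' _).ne' (gaussianPDF_pos _ hvs.ne' _).ne'

theorem lintegral_stepDensity {vε vs : ℝ≥0} (hvε : 0 < vε) (hvs : 0 < vs) (τ : ℝ × ℝ) :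
    ∫⁻ τ', stepDensity vε vs τ τ' = 1 := by
  unfold stepDensity
  rw [Measure.volume_eq_prod, lintegral_prod_mul (measurable_gaussianPDF _ _).aemeasurable
    (measurable_gaussianPDF _ _).aemeasurable, lintegral_gaussianPDF_eq_one _ hvε.ne',
    lintegral_gaussianPDF_eq_one _ hvs.ne', one_mul]

theorem lintegral_proposal {vε vs : ℝ≥0} (hvε : 0 < vε) (hvs : 0 < vs) (τ : ℝ × ℝ)
    {f : ℝ × ℝ → ℝ≥0∞} (hf : Measurable f) :
    ∫⁻ θ', f θ' ∂(proposal vε vs (ofLog τ)) =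
      ∫⁻ τ', stepDensity vε vs τ τ' * f (ofLog τ') := by
  have := Kernel.IsMarkovKernel.map (gaussianKernel vε) Real.measurable_exp
  have h1 : proposal vε vs (ofLog τ) =
      ((gaussianReal τ.1 vε).map Real.exp).prod (gaussianReal τ.2 vs) := by
    rw [proposal, Kernel.prod_apply, Kernel.comap_apply, Kernel.comap_apply,
      Kernel.map_apply _ Real.measurable_exp]
    simp only [ofLog, Real.log_exp]
    rfl
  rw [h1, lintegral_prod _ hf.aemeasurable, lintegral_map (by fun_prop) Real.measurable_exp,
    Measure.volume_eq_prod, lintegral_prod _ (by fun_prop), gaussianReal_of_var_ne_zero _ hvε.ne',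
    gaussianReal_of_var_ne_zero _ hvs.ne',
    lintegral_withDensity_eq_lintegral_mul _ (measurable_gaussianPDF _ _)
      (Measurable.lintegral_prod_right' (f := fun q : ℝ × ℝ => f (Real.exp q.1, q.2))
        (by fun_prop))]
  refine lintegral_congr fun t => ?_
  rw [Pi.mul_apply, lintegral_withDensity_eq_lintegral_mul _ (measurable_gaussianPDF _ _)
    (by fun_prop), ← lintegral_const_mul _ (by
      exact (measurable_gaussianPDF _ _).mul (by fun_prop))]
  refine lintegral_congr fun s => ?_
  simp only [Pi.mul_apply, stepDensity, ofLog]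
  rw [mul_assoc]

/-- The density of the parameters in logarithmic coordinates. -/
noncomputable def Model.logPrior (M : Model n) (θ : ℝ × ℝ) : ℝ≥0∞ :=
  ENNReal.ofReal (M.paramPrior θ * θ.1)

@[fun_prop]
theorem Model.measurable_logPrior {Ω : Type*} [MeasurableSpace Ω] (M : Model n) {θ : Ω → ℝ × ℝ}
    (hθ : Measurable θ) : Measurable fun ω => M.logPrior (θ ω) := by
  unfold Model.logPrior
  fun_prop

/-- The Jacobian `exp τ.1 = ε` is absorbed in `logPrior`. Nothing is lost outside `ε > 0`: the prior
vanishes for `ε < 0`, and `ε = 0` is a null set. -/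
theorem Model.lintegral_jointMeasure_ofLog (M : Model n) (ha : 0 < M.a) (hb : 0 < M.b)
    {f : State n → ℝ≥0∞} (hf : Measurable f) :
    ∫⁻ x, f x ∂M.jointMeasure = ∫⁻ τ, M.logPrior (ofLog τ) *
      ∫⁻ z, M.prodWeight (ofLog τ) z * f (ofLog τ, z) ∂(pointsLaw n) := by
  rw [M.lintegral_jointMeasure ha hb hf]
  simp only [M.lintegral_prodWeight_mul]
  set I : ℝ × ℝ → ℝ≥0∞ := fun θ => ∫⁻ z, M.prodWeight θ z * f (θ, z) ∂(pointsLaw n)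
  have hI : Measurable I := by
    have : Measurable fun q : (ℝ × ℝ) × (Fin n → ℝ × ℝ) => M.prodWeight q.1 q.2 * f (q.1, q.2) := by
      fun_prop
    exact this.lintegral_prod_right'
  have hset : MeasurableSet (Set.Ioi (0 : ℝ) ×ˢ (Set.univ : Set ℝ)) := measurableSet_Ioi.prod .univ
  have h0 : ∀ᵐ θ : ℝ × ℝ, θ.1 ≠ 0 :=
    Measure.quasiMeasurePreserving_fst.ae (p := fun x : ℝ => x ≠ 0) (Measure.ae_ne volume 0)
  have h1 : ∫⁻ θ, ENNReal.ofReal (M.paramPrior θ) * I θ =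
      ∫⁻ θ in Set.Ioi (0 : ℝ) ×ˢ Set.univ, ENNReal.ofReal (M.paramPrior θ) * I θ := by
    rw [← lintegral_indicator hset]
    refine lintegral_congr_ae ?_
    filter_upwards [h0] with θ hθ
    rcases lt_or_gt_of_ne hθ with h | h
    · rw [Set.indicator_of_notMem (fun h' => lt_asymm h h'.1), M.paramPrior_of_neg h]
      simp
    · rw [Set.indicator_of_mem (show θ ∈ Set.Ioi (0 : ℝ) ×ˢ Set.univ from ⟨h, trivial⟩)]
  rw [h1, lintegral_ofLog (by fun_prop)]
  refine lintegral_congr fun τ => ?_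
  rw [← mul_assoc, mul_comm (ENNReal.ofReal (Real.exp τ.1)),
    ← ENNReal.ofReal_mul (M.paramPrior_nonneg ha hb _)]
  rfl

/-! ### Detailed balance -/

/-- True also for `a = 0`, so detailed balance needs no positivity of the denominator. -/
theorem mul_min_one_div {a b : ℝ} (ha : 0 ≤ a) (hb : 0 ≤ b) : a * min 1 (b / a) = min a b := by
  rcases ha.eq_or_lt with rfl | ha
  · simp [hb]
  · rw [mul_min_of_nonneg _ _ ha.le, mul_one, mul_div_cancel₀ _ ha.ne']

theorem Model.logPrior_mul_totalWeight (M : Model n) (ha : 0 < M.a) (hb : 0 < M.b) {θ : ℝ × ℝ}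
    (hθ : 0 < θ.1) (p : Fin n → Fin K → ℝ × ℝ) :
    M.logPrior θ * M.totalWeight θ p =
      ENNReal.ofReal (M.paramPrior θ * θ.1 * ∏ j, ∑ k, M.weight j θ (p j k)) := by
  rw [ENNReal.ofReal_mul (mul_nonneg (M.paramPrior_nonneg ha hb _) hθ.le), Model.logPrior,
    Model.totalWeight, ENNReal.ofReal_prod_of_nonneg
      fun j _ => Finset.sum_nonneg fun k _ => M.weight_nonneg _ _ _]
  congr 1
  refine Finset.prod_congr rfl fun j _ => ?_
  rw [ENNReal.ofReal_sum_of_nonneg fun k _ => M.weight_nonneg _ _ _]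

/-- Both sides are the minimum of the two target densities at the array `p`. -/
theorem Model.detailed_balance (M : Model n) (ha : 0 < M.a) (hb : 0 < M.b) {θ θ' : ℝ × ℝ}
    (hθ : 0 < θ.1) (hθ' : 0 < θ'.1) (p : Fin n → Fin K → ℝ × ℝ) :
    M.logPrior θ * M.totalWeight θ p * ENNReal.ofReal (M.accept θ θ' p) =
      M.logPrior θ' * M.totalWeight θ' p * ENNReal.ofReal (M.accept θ' θ p) := by
  have hnn : ∀ {θ : ℝ × ℝ}, 0 < θ.1 →
      0 ≤ M.paramPrior θ * θ.1 * ∏ j, ∑ k, M.weight j θ (p j k) := fun hθ =>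
    mul_nonneg (mul_nonneg (M.paramPrior_nonneg ha hb _) hθ.le) (Finset.prod_nonneg fun j _ =>
      Finset.sum_nonneg fun k _ => M.weight_nonneg _ _ _)
  have hacc : ∀ θ θ' : ℝ × ℝ, M.accept θ θ' p =
      min 1 ((M.paramPrior θ' * θ'.1 * ∏ j, ∑ k, M.weight j θ' (p j k)) /
        (M.paramPrior θ * θ.1 * ∏ j, ∑ k, M.weight j θ (p j k))) := fun θ θ' => by
    rw [Model.accept, Finset.prod_div_distrib, div_mul_div_comm]
  rw [M.logPrior_mul_totalWeight ha hb hθ, M.logPrior_mul_totalWeight ha hb hθ', hacc, hacc,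
    ← ENNReal.ofReal_mul (hnn hθ), ← ENNReal.ofReal_mul (hnn hθ'),
    mul_min_one_div (hnn hθ) (hnn hθ'), mul_min_one_div (hnn hθ') (hnn hθ), min_comm]

/-! ### Invariance -/

theorem ofReal_accept_le_one (M : Model n) (θ θ' : ℝ × ℝ) (p : Fin n → Fin K → ℝ × ℝ) :
    ENNReal.ofReal (M.accept θ θ' p) ≤ 1 :=
  ENNReal.ofReal_le_one.2 (min_le_left _ _)

theorem assemble_zero (hK : 0 < K) (z : Fin n → ℝ × ℝ) (y : Fin n → Fresh K → ℝ × ℝ) :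
    (fun j => assemble z y j ⟨0, hK⟩) = z := by
  funext j
  simp [assemble]

theorem Model.lintegral_mcmcKernel_ofLog (M : Model n) {vε vs : ℝ≥0} (hvε : 0 < vε)
    (hvs : 0 < vs) (τ : ℝ × ℝ) (z : Fin n → ℝ × ℝ) {f : State n → ℝ≥0∞} (hf : Measurable f) :
    ∫⁻ y, f y ∂(M.mcmcKernel K vε vs (ofLog τ, z)) =
      ∫⁻ τ', stepDensity vε vs τ τ' * ∫⁻ y,
        (ENNReal.ofReal (M.accept (ofLog τ) (ofLog τ') (assemble z y)) *
          M.selectMean f (ofLog τ') (assemble z y) +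
        (1 - ENNReal.ofReal (M.accept (ofLog τ) (ofLog τ') (assemble z y))) *
          M.selectMean f (ofLog τ) (assemble z y)) ∂(freshLaw n K) := by
  rw [M.lintegral_mcmcKernel vε vs _ hf]
  refine lintegral_proposal hvε hvs τ (f := fun θ' => ∫⁻ y,
        (ENNReal.ofReal (M.accept (ofLog τ) θ' (assemble z y)) *
          M.selectMean f θ' (assemble z y) +
        (1 - ENNReal.ofReal (M.accept (ofLog τ) θ' (assemble z y))) *
          M.selectMean f (ofLog τ) (assemble z y)) ∂(freshLaw n K)) ?_
  exact Measurable.lintegral_prod_right'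
    (f := fun q : (ℝ × ℝ) × (Fin n → Fresh K → ℝ × ℝ) =>
      ENNReal.ofReal (M.accept (ofLog τ) q.1 (assemble z q.2)) *
          M.selectMean f q.1 (assemble z q.2) +
        (1 - ENNReal.ofReal (M.accept (ofLog τ) q.1 (assemble z q.2))) *
          M.selectMean f (ofLog τ) (assemble z q.2)) (by fun_prop)

/-- The current points occupy index `0` of the array, so the weight `w` can be read off the array
and Tonelli applies. -/
theorem lintegral_mul_lintegral_assemble (hK : 0 < K) {w : (Fin n → ℝ × ℝ) → ℝ≥0∞}
    (hw : Measurable w) {q : ℝ × ℝ → ℝ≥0∞} (hq : Measurable q)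
    {C : (ℝ × ℝ) → (Fin n → Fin K → ℝ × ℝ) → ℝ≥0∞}
    (hC : Measurable fun r : (ℝ × ℝ) × (Fin n → Fin K → ℝ × ℝ) => C r.1 r.2) :
    ∫⁻ z, w z * (∫⁻ τ, q τ * ∫⁻ y, C τ (assemble z y) ∂(freshLaw n K)) ∂(pointsLaw n) =
      ∫⁻ τ, q τ * ∫⁻ p, w (fun j => p j ⟨0, hK⟩) * C τ p ∂(gridLaw n K) := by
  have hC' : Measurable fun r : ((Fin n → ℝ × ℝ) × (ℝ × ℝ)) × (Fin n → Fresh K → ℝ × ℝ) =>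
      C r.1.2 (assemble r.1.1 r.2) :=
    hC.comp (f := fun r : ((Fin n → ℝ × ℝ) × (ℝ × ℝ)) × (Fin n → Fresh K → ℝ × ℝ) =>
      (r.1.2, assemble r.1.1 r.2)) (by fun_prop)
  have hI : Measurable fun r : (Fin n → ℝ × ℝ) × (ℝ × ℝ) =>
      ∫⁻ y, C r.2 (assemble r.1 y) ∂(freshLaw n K) := hC'.lintegral_prod_right'
  have hIz : ∀ z, Measurable fun τ => ∫⁻ y, C τ (assemble z y) ∂(freshLaw n K) :=
    fun z => hI.comp measurable_prodMk_left
  have hIτ : ∀ τ, Measurable fun z => ∫⁻ y, C τ (assemble z y) ∂(freshLaw n K) :=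
    fun τ => hI.comp measurable_prodMk_right
  have hCτ : ∀ τ, Measurable (C τ) := fun τ => hC.comp measurable_prodMk_left
  have hF : Measurable fun r : (Fin n → ℝ × ℝ) × (ℝ × ℝ) =>
      w r.1 * (q r.2 * ∫⁻ y, C r.2 (assemble r.1 y) ∂(freshLaw n K)) := by fun_prop
  calc ∫⁻ z, w z * (∫⁻ τ, q τ * ∫⁻ y, C τ (assemble z y) ∂(freshLaw n K)) ∂(pointsLaw n)
      = ∫⁻ z, (∫⁻ τ, w z * (q τ * ∫⁻ y, C τ (assemble z y) ∂(freshLaw n K)))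
          ∂(pointsLaw n) := by
        refine lintegral_congr fun z => ?_
        exact (lintegral_const_mul _ (hq.mul (hIz z))).symm
    _ = ∫⁻ τ, (∫⁻ z, w z * (q τ * ∫⁻ y, C τ (assemble z y) ∂(freshLaw n K))
          ∂(pointsLaw n)) := lintegral_lintegral_swap hF.aemeasurable
    _ = _ := by
        refine lintegral_congr fun τ => ?_
        rw [← lintegral_assemble hK (by fun_prop)]
        have hw' : ∀ z : Fin n → ℝ × ℝ, ∫⁻ y, w (fun j => assemble z y j ⟨0, hK⟩) *
            C τ (assemble z y) ∂(freshLaw n K) =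
            w z * ∫⁻ y, C τ (assemble z y) ∂(freshLaw n K) := fun z => by
          simp only [assemble_zero hK]
          rw [lintegral_const_mul _ (by fun_prop)]
        simp only [hw']
        simp only [mul_left_comm (w _)]
        exact lintegral_const_mul _ (hw.mul (hIτ τ))

/-- One step of the chain, started from a point `z` with density proportional to its weight. -/
theorem Model.lintegral_prodWeight_mul_mcmcKernel (M : Model n) (hK : 0 < K) {vε vs : ℝ≥0}
    (hvε : 0 < vε) (hvs : 0 < vs) (τ : ℝ × ℝ) {f : State n → ℝ≥0∞} (hf : Measurable f) :
    ∫⁻ z, M.prodWeight (ofLog τ) z * ∫⁻ y, f y ∂(M.mcmcKernel K vε vs (ofLog τ, z))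
        ∂(pointsLaw n) =
      ∫⁻ τ', stepDensity vε vs τ τ' *
        (∫⁻ p, M.prodWeight (ofLog τ) (fun j => p j ⟨0, hK⟩) *
            (ENNReal.ofReal (M.accept (ofLog τ) (ofLog τ') p) * M.selectMean f (ofLog τ') p)
            ∂(gridLaw n K) +
          ∫⁻ p, M.prodWeight (ofLog τ) (fun j => p j ⟨0, hK⟩) *
            ((1 - ENNReal.ofReal (M.accept (ofLog τ) (ofLog τ') p)) *
              f (ofLog τ, fun j => p j ⟨0, hK⟩)) ∂(gridLaw n K)) := by
  simp only [M.lintegral_mcmcKernel_ofLog hvε hvs τ _ hf]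
  rw [lintegral_mul_lintegral_assemble hK (w := M.prodWeight (ofLog τ)) (by fun_prop)
    (q := stepDensity vε vs τ) (by fun_prop) (C := fun τ' p =>
      ENNReal.ofReal (M.accept (ofLog τ) (ofLog τ') p) * M.selectMean f (ofLog τ') p +
        (1 - ENNReal.ofReal (M.accept (ofLog τ) (ofLog τ') p)) * M.selectMean f (ofLog τ) p)
      (by fun_prop)]
  refine lintegral_congr fun τ' => ?_
  congr 1
  simp only [mul_add]
  rw [lintegral_add_left (by fun_prop)]
  congr 1
  refine M.lintegral_prodWeight_mul_selectMean ⟨0, hK⟩ (ofLog τ) hf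
    (G := fun p => 1 - ENNReal.ofReal (M.accept (ofLog τ) (ofLog τ') p)) (by fun_prop) ?_
  intro σ p
  dsimp only
  rw [M.exchangeable_accept (ofLog τ) (ofLog τ') σ p]

/-- Symmetrising turns the weight of the current points into `totalWeight`, where detailed balance
holds array by array; at `θ'`, desymmetrising turns the selection mean into evaluation at the points
of index `i`. -/
theorem Model.lintegral_accept_balance (M : Model n) (ha : 0 < M.a) (hb : 0 < M.b) (i : Fin K)
    (τ τ' : ℝ × ℝ) {f : State n → ℝ≥0∞} (hf : Measurable f) :
    M.logPrior (ofLog τ) * ∫⁻ p, M.prodWeight (ofLog τ) (fun j => p j i) *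
        (ENNReal.ofReal (M.accept (ofLog τ) (ofLog τ') p) * M.selectMean f (ofLog τ') p)
        ∂(gridLaw n K) =
      M.logPrior (ofLog τ') * ∫⁻ p, M.prodWeight (ofLog τ') (fun j => p j i) *
        (ENNReal.ofReal (M.accept (ofLog τ') (ofLog τ) p) * f (ofLog τ', fun j => p j i))
        ∂(gridLaw n K) := by
  have hK : (K : ℝ≥0∞) ^ n ≠ 0 := pow_ne_zero _ (by simpa using (Fin.pos i).ne')
  have hK' : (K : ℝ≥0∞) ^ n ≠ ∞ := ENNReal.pow_ne_top (ENNReal.natCast_ne_top _)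
  refine (ENNReal.mul_right_inj hK hK').1 ?_
  rw [mul_left_comm, mul_left_comm ((K : ℝ≥0∞) ^ n),
    ← M.lintegral_totalWeight_mul_selectMean i (ofLog τ') hf
      (G := fun p => ENNReal.ofReal (M.accept (ofLog τ') (ofLog τ) p)) (by fun_prop)
      (fun σ p => by dsimp only; rw [M.exchangeable_accept _ _ σ p]),
    ← M.lintegral_totalWeight_mul i (ofLog τ)
      (G := fun p => ENNReal.ofReal (M.accept (ofLog τ) (ofLog τ') p) *
        M.selectMean f (ofLog τ') p) (by fun_prop)
      (fun σ p => by
        dsimp only; rw [M.exchangeable_accept _ _ σ p, M.exchangeable_selectMean _ _ σ p]),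
    ← lintegral_const_mul _ (by fun_prop), ← lintegral_const_mul _ (by fun_prop)]
  refine lintegral_congr fun p => ?_
  rw [← mul_assoc, ← mul_assoc, ← mul_assoc, ← mul_assoc,
    M.detailed_balance ha hb (ofLog_fst_pos τ) (ofLog_fst_pos τ')]

/-- Integrated form of the invariance of a Metropolis step with symmetric proposal density `q`. -/
theorem lintegral_metropolis {c I : ℝ × ℝ → ℝ≥0∞} (hc : Measurable c)
    {q U V W : ℝ × ℝ → ℝ × ℝ → ℝ≥0∞} (hq : Measurable fun r : (ℝ × ℝ) × (ℝ × ℝ) => q r.1 r.2)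
    (hU : Measurable fun r : (ℝ × ℝ) × (ℝ × ℝ) => U r.1 r.2)
    (hV : Measurable fun r : (ℝ × ℝ) × (ℝ × ℝ) => V r.1 r.2)
    (hW : Measurable fun r : (ℝ × ℝ) × (ℝ × ℝ) => W r.1 r.2)
    (hqs : ∀ τ τ', q τ τ' = q τ' τ) (hq1 : ∀ τ, ∫⁻ τ', q τ τ' = 1)
    (hUW : ∀ τ τ', c τ * U τ τ' = c τ' * W τ' τ) (hWV : ∀ τ τ', W τ τ' + V τ τ' = I τ) :
    ∫⁻ τ, c τ * ∫⁻ τ', q τ τ' * (U τ τ' + V τ τ') = ∫⁻ τ, c τ * I τ := by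
  have hcU : Measurable fun r : (ℝ × ℝ) × (ℝ × ℝ) => c r.1 * q r.1 r.2 * U r.1 r.2 := by fun_prop
  have hcW : Measurable fun r : (ℝ × ℝ) × (ℝ × ℝ) => c r.1 * q r.1 r.2 * W r.1 r.2 := by fun_prop
  have hcUτ : ∀ τ, Measurable fun τ' => c τ * q τ τ' * U τ τ' :=
    fun τ => hcU.comp measurable_prodMk_left
  have hcWτ : ∀ τ, Measurable fun τ' => c τ * q τ τ' * W τ τ' :=
    fun τ => hcW.comp measurable_prodMk_left
  have hqτ : ∀ τ, Measurable (q τ) := fun τ => hq.comp measurable_prodMk_left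
  have hUV : ∀ τ, Measurable fun τ' => q τ τ' * (U τ τ' + V τ τ') :=
    fun τ => (hq.mul (hU.add hV)).comp measurable_prodMk_left
  -- The accepted flow into a state equals the accepted flow out of it: exchange the variables and
  -- use `hUW` and the symmetry of `q`.
  have hswap : ∫⁻ τ, ∫⁻ τ', c τ * q τ τ' * U τ τ' = ∫⁻ τ, ∫⁻ τ', c τ * q τ τ' * W τ τ' := by
    have h : ∀ τ τ', c τ * q τ τ' * U τ τ' = c τ' * q τ' τ * W τ' τ := fun τ τ' => by
      rw [mul_right_comm, hUW, mul_right_comm, hqs]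
    simp only [h]
    exact lintegral_lintegral_swap (hcW.comp measurable_swap).aemeasurable
  calc ∫⁻ τ, c τ * ∫⁻ τ', q τ τ' * (U τ τ' + V τ τ')
      = ∫⁻ τ, ((∫⁻ τ', c τ * q τ τ' * U τ τ') + ∫⁻ τ', c τ * q τ τ' * V τ τ') := by
        refine lintegral_congr fun τ => ?_
        rw [← lintegral_add_left (hcUτ τ), ← lintegral_const_mul _ (hUV τ)]
        refine lintegral_congr fun τ' => ?_
        ring
    _ = ∫⁻ τ, ((∫⁻ τ', c τ * q τ τ' * W τ τ') + ∫⁻ τ', c τ * q τ τ' * V τ τ') := by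
        rw [lintegral_add_left hcU.lintegral_prod_right', hswap,
          lintegral_add_left hcW.lintegral_prod_right']
    _ = _ := by
        refine lintegral_congr fun τ => ?_
        rw [← lintegral_add_left (hcWτ τ)]
        simp only [← mul_add, hWV]
        rw [lintegral_mul_const _ ((hqτ τ).const_mul _), lintegral_const_mul _ (hqτ τ), hq1,
          mul_one]

theorem Model.lintegral_accept_add_reject (M : Model n) (i : Fin K) (θ θ' : ℝ × ℝ)
    {f : State n → ℝ≥0∞} (hf : Measurable f) :
    ∫⁻ p, M.prodWeight θ (fun j => p j i) *
        (ENNReal.ofReal (M.accept θ θ' p) * f (θ, fun j => p j i)) ∂(gridLaw n K) +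
      ∫⁻ p, M.prodWeight θ (fun j => p j i) *
        ((1 - ENNReal.ofReal (M.accept θ θ' p)) * f (θ, fun j => p j i)) ∂(gridLaw n K) =
      ∫⁻ z, M.prodWeight θ z * f (θ, z) ∂(pointsLaw n) := by
  rw [← lintegral_add_left (by fun_prop),
    ← (measurePreserving_select fun _ : Fin n => i).lintegral_comp
      (f := fun z => M.prodWeight θ z * f (θ, z)) (by fun_prop)]
  refine lintegral_congr fun p => ?_
  rw [← mul_add, ← add_mul, add_tsub_cancel_of_le (ofReal_accept_le_one _ _ _ _), one_mul]

theorem Model.lintegral_mcmcKernel_jointMeasure (M : Model n) (ha : 0 < M.a) (hb : 0 < M.b)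
    (hK : 0 < K) {vε vs : ℝ≥0} (hvε : 0 < vε) (hvs : 0 < vs) {f : State n → ℝ≥0∞}
    (hf : Measurable f) :
    ∫⁻ x, ∫⁻ y, f y ∂(M.mcmcKernel K vε vs x) ∂M.jointMeasure = ∫⁻ x, f x ∂M.jointMeasure := by
  have hPf : Measurable fun x => ∫⁻ y, f y ∂(M.mcmcKernel K vε vs x) := hf.lintegral_kernel
  rw [M.lintegral_jointMeasure_ofLog ha hb hPf, M.lintegral_jointMeasure_ofLog ha hb hf]
  simp only [M.lintegral_prodWeight_mul_mcmcKernel hK hvε hvs _ hf]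
  refine lintegral_metropolis (c := fun τ => M.logPrior (ofLog τ)) (by fun_prop)
    (q := stepDensity vε vs) (by fun_prop)
    (W := fun τ τ' => ∫⁻ p, M.prodWeight (ofLog τ) (fun j => p j ⟨0, hK⟩) *
      (ENNReal.ofReal (M.accept (ofLog τ) (ofLog τ') p) *
        f (ofLog τ, fun j => p j ⟨0, hK⟩)) ∂(gridLaw n K)) ?_ ?_ ?_
    (stepDensity_comm vε vs) (lintegral_stepDensity hvε hvs)
    (fun τ τ' => M.lintegral_accept_balance ha hb ⟨0, hK⟩ τ τ' hf)
    (fun τ τ' => M.lintegral_accept_add_reject ⟨0, hK⟩ (ofLog τ) (ofLog τ') hf)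
  · exact Measurable.lintegral_prod_right' (f := fun r : ((ℝ × ℝ) × (ℝ × ℝ)) ×
      (Fin n → Fin K → ℝ × ℝ) => M.prodWeight (ofLog r.1.1) (fun j => r.2 j ⟨0, hK⟩) *
      (ENNReal.ofReal (M.accept (ofLog r.1.1) (ofLog r.1.2) r.2) *
        M.selectMean f (ofLog r.1.2) r.2)) (by fun_prop)
  · exact Measurable.lintegral_prod_right' (f := fun r : ((ℝ × ℝ) × (ℝ × ℝ)) ×
      (Fin n → Fin K → ℝ × ℝ) => M.prodWeight (ofLog r.1.1) (fun j => r.2 j ⟨0, hK⟩) *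
      ((1 - ENNReal.ofReal (M.accept (ofLog r.1.1) (ofLog r.1.2) r.2)) *
        f (ofLog r.1.1, fun j => r.2 j ⟨0, hK⟩))) (by fun_prop)
  · exact Measurable.lintegral_prod_right' (f := fun r : ((ℝ × ℝ) × (ℝ × ℝ)) ×
      (Fin n → Fin K → ℝ × ℝ) => M.prodWeight (ofLog r.1.1) (fun j => r.2 j ⟨0, hK⟩) *
      (ENNReal.ofReal (M.accept (ofLog r.1.1) (ofLog r.1.2) r.2) *
        f (ofLog r.1.1, fun j => r.2 j ⟨0, hK⟩))) (by fun_prop)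

/-! ### Support and positivity of the transitions -/

theorem Model.weight_pos_of_selectWeight_ne_zero (M : Model n) {θ : ℝ × ℝ}
    {p : Fin n → Fin K → ℝ × ℝ} {k : Fin n → Fin K}
    (hsum : ∀ j, ∑ l, M.weight j θ (p j l) ≠ 0) (h : M.selectWeight θ p k ≠ 0) (j : Fin n) :
    0 < M.weight j θ (p j (k j)) := by
  have hj : ENNReal.ofReal (selectProb (fun l => M.weight j θ (p j l)) (k j)) ≠ 0 :=
    fun h0 => h (Finset.prod_eq_zero (Finset.mem_univ j) h0)
  refine lt_of_le_of_ne (M.weight_nonneg _ _ _) fun h0 => hj ?_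
  rw [selectProb, if_neg (hsum j), ← h0, zero_div, ENNReal.ofReal_zero]

theorem Model.selectMean_eq_zero (M : Model n) (ha : 0 < M.a) (hb : 0 < M.b) {θ : ℝ × ℝ}
    (hθ : 0 < θ.1) (hPP : 0 < M.paramPrior θ) {p : Fin n → Fin K → ℝ × ℝ}
    (hsum : ∀ j, ∑ l, M.weight j θ (p j l) ≠ 0) {f : State n → ℝ≥0∞}
    (hf : ∀ k : Fin n → Fin K, (θ, fun j => p j (k j)) ∈ M.stateSpace →
      f (θ, fun j => p j (k j)) = 0) :
    M.selectMean f θ p = 0 := by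
  refine Finset.sum_eq_zero fun k _ => ?_
  by_cases hk : M.selectWeight θ p k = 0
  · rw [hk, zero_mul]
  · rw [hf k ((M.mem_stateSpace_iff ha hb _).2
      ⟨hθ, hPP, M.weight_pos_of_selectWeight_ne_zero (θ := θ) (p := p) (k := k) hsum hk⟩), mul_zero]

/-- A positive acceptance probability forces a positive prior, `ε' > 0` and a nonzero total weight
in each group; selection then picks points of positive weight only, so it lands in the state space.
-/
theorem Model.accept_mul_selectMean_eq_zero (M : Model n) (ha : 0 < M.a) (hb : 0 < M.b)
    (θ : ℝ × ℝ) {θ' : ℝ × ℝ} {p : Fin n → Fin K → ℝ × ℝ} {f : State n → ℝ≥0∞}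
    (hf : ∀ k : Fin n → Fin K, (θ', fun j => p j (k j)) ∈ M.stateSpace →
      f (θ', fun j => p j (k j)) = 0) :
    ENNReal.ofReal (M.accept θ θ' p) * M.selectMean f θ' p = 0 := by
  by_cases hacc : M.accept θ θ' p ≤ 0
  · rw [ENNReal.ofReal_of_nonpos hacc, zero_mul]
  rw [not_le, Model.accept, lt_min_iff] at hacc
  have hne := hacc.2.ne'
  simp only [mul_ne_zero_iff, div_ne_zero_iff, Finset.prod_ne_zero_iff] at hne
  obtain ⟨⟨⟨h1, h2⟩, _⟩, h3⟩ := hne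
  have hθ' : 0 < θ'.1 := by
    refine lt_of_le_of_ne ?_ (Ne.symm h2)
    by_contra h
    exact h1 (M.paramPrior_of_neg (not_le.1 h))
  rw [M.selectMean_eq_zero ha hb hθ' (lt_of_le_of_ne (M.paramPrior_nonneg ha hb _) (Ne.symm h1))
    (fun j => (h3 j (Finset.mem_univ j)).1) hf, mul_zero]

theorem Model.sum_weight_pos (M : Model n) {θ : ℝ × ℝ} {p : Fin n → Fin K → ℝ × ℝ} {j : Fin n}
    {k : Fin K} (h : 0 < M.weight j θ (p j k)) : 0 < ∑ l, M.weight j θ (p j l) :=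
  h.trans_le (Finset.single_le_sum (f := fun l => M.weight j θ (p j l))
    (fun _ _ => M.weight_nonneg _ _ _) (Finset.mem_univ k))

theorem Model.sum_weight_assemble_pos (M : Model n) (ha : 0 < M.a) (hb : 0 < M.b) (hK : 0 < K)
    {x : State n} (hx : x ∈ M.stateSpace) (y : Fin n → Fresh K → ℝ × ℝ) (j : Fin n) :
    0 < ∑ l, M.weight j x.1 (assemble x.2 y j l) := by
  refine M.sum_weight_pos (p := assemble x.2 y) (k := ⟨0, hK⟩) ?_
  rw [congrFun (assemble_zero hK x.2 y) j]
  exact ((M.mem_stateSpace_iff ha hb _).1 hx).2.2 j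

theorem Model.mcmcKernel_compl_stateSpace (M : Model n) (ha : 0 < M.a) (hb : 0 < M.b)
    (hK : 0 < K) (vε vs : ℝ≥0) {x : State n} (hx : x ∈ M.stateSpace) :
    M.mcmcKernel K vε vs x M.stateSpaceᶜ = 0 := by
  have hS := M.measurableSet_stateSpace
  have hf : Measurable (M.stateSpaceᶜ.indicator (1 : State n → ℝ≥0∞)) :=
    measurable_one.indicator hS.compl
  rw [← lintegral_indicator_one hS.compl, M.lintegral_mcmcKernel vε vs x hf]
  have hx' := (M.mem_stateSpace_iff ha hb _).1 hx
  have h0 : ∀ y : State n, y ∈ M.stateSpace →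
      M.stateSpaceᶜ.indicator (1 : State n → ℝ≥0∞) y = 0 := fun y hy =>
    Set.indicator_of_notMem (Set.notMem_compl_iff.2 hy) _
  have hz : ∀ θ' (y : Fin n → Fresh K → ℝ × ℝ),
      ENNReal.ofReal (M.accept x.1 θ' (assemble x.2 y)) *
          M.selectMean (M.stateSpaceᶜ.indicator 1) θ' (assemble x.2 y) +
        (1 - ENNReal.ofReal (M.accept x.1 θ' (assemble x.2 y))) *
          M.selectMean (M.stateSpaceᶜ.indicator 1) x.1 (assemble x.2 y) = 0 := fun θ' y => by
    rw [M.accept_mul_selectMean_eq_zero ha hb x.1 fun k hk => h0 _ hk,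
      M.selectMean_eq_zero ha hb hx'.1 hx'.2.1
        (fun j => (M.sum_weight_assemble_pos ha hb hK hx y j).ne') fun k hk => h0 _ hk,
      mul_zero, add_zero]
  simp only [hz, lintegral_zero]

/-- The index of the first fresh point. -/
def firstFresh (hK : 1 < K) : Fresh K := ⟨⟨1, hK⟩, one_ne_zero⟩

theorem assemble_one (hK : 1 < K) (z : Fin n → ℝ × ℝ) (y : Fin n → Fresh K → ℝ × ℝ) :
    (fun j => assemble z y j ⟨1, hK⟩) = fun j => y j (firstFresh hK) := by
  funext j
  simp [assemble, firstFresh]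

/-- Here `1 < K` matters: a fresh point makes the proposed weights positive even when the current
points are incompatible with `θ'`. -/
theorem Model.accept_assemble_pos (M : Model n) (ha : 0 < M.a) (hb : 0 < M.b) (hK : 1 < K)
    {x : State n} (hx : x ∈ M.stateSpace) {θ' : ℝ × ℝ} {y : Fin n → Fresh K → ℝ × ℝ}
    (hy : (θ', fun j => y j (firstFresh hK)) ∈ M.stateSpace) :
    0 < M.accept x.1 θ' (assemble x.2 y) ∧
      M.selectWeight θ' (assemble x.2 y) (fun _ => ⟨1, hK⟩) ≠ 0 := by
  have hx' := (M.mem_stateSpace_iff ha hb _).1 hx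
  have hy' := (M.mem_stateSpace_iff ha hb _).1 hy
  have hw : ∀ j, 0 < M.weight j θ' (assemble x.2 y j ⟨1, hK⟩) := fun j => by
    rw [congrFun (assemble_one hK x.2 y) j]
    exact hy'.2.2 j
  have hs : ∀ j, 0 < ∑ l, M.weight j θ' (assemble x.2 y j l) := fun j =>
    M.sum_weight_pos (p := assemble x.2 y) (hw j)
  constructor
  · refine lt_min one_pos (mul_pos (div_pos (mul_pos hy'.2.1 hy'.1) (mul_pos hx'.2.1 hx'.1)) ?_)
    exact Finset.prod_pos fun j _ =>
      div_pos (hs j) (M.sum_weight_assemble_pos ha hb (zero_lt_one.trans hK) hx y j)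
  · refine Finset.prod_ne_zero_iff.2 fun j _ => (ENNReal.ofReal_pos.2 ?_).ne'
    rw [selectProb, if_neg (hs j).ne']
    exact div_pos (hw j) (hs j)

theorem Model.jointMeasure_compl_stateSpace (M : Model n) (ha : 0 < M.a) (hb : 0 < M.b) :
    M.jointMeasure M.stateSpaceᶜ = 0 := by
  have hS := M.measurableSet_stateSpace.compl
  rw [← lintegral_indicator_one hS,
    M.lintegral_jointMeasure_ofLog ha hb (measurable_one.indicator hS)]
  have h0 : ∀ τ z, M.logPrior (ofLog τ) * (M.prodWeight (ofLog τ) z *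
      M.stateSpaceᶜ.indicator (1 : State n → ℝ≥0∞) (ofLog τ, z)) = 0 := fun τ z => by
    by_contra h
    simp only [mul_ne_zero_iff, ← ne_eq, Set.indicator_apply_ne_zero] at h
    refine h.2.2.1 ((M.mem_stateSpace_iff ha hb _).2 ⟨ofLog_fst_pos τ, ?_,
      M.prodWeight_ne_zero_iff.1 h.2.1⟩)
    have h1 := ENNReal.ofReal_pos.1 (pos_iff_ne_zero.2 h.1)
    exact pos_of_mul_pos_left h1 (ofLog_fst_pos τ).le
  refine (lintegral_congr fun τ => ?_).trans lintegral_zero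
  rw [← lintegral_const_mul _ (by
    have := measurable_one.indicator (β := ℝ≥0∞) hS
    fun_prop)]
  exact (lintegral_congr fun z => h0 τ z).trans lintegral_zero

/-- In logarithmic coordinates the joint measure has a density with respect to Lebesgue measure
times the law of one uniform point per group, and the first fresh points have the latter law. -/
theorem Model.ae_jointMeasure_of_fresh (M : Model n) (ha : 0 < M.a) (hb : 0 < M.b) (hK : 1 < K)
    {q : State n → Prop} (hq : MeasurableSet {x | q x})
    (h : ∀ᵐ τ : ℝ × ℝ, ∀ᵐ y ∂(freshLaw n K), q (ofLog τ, fun j => y j (firstFresh hK))) :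
    ∀ᵐ x ∂M.jointMeasure, q x := by
  rw [ae_iff, ← Set.compl_ofPred, ← lintegral_indicator_one hq.compl,
    M.lintegral_jointMeasure_ofLog ha hb (measurable_one.indicator hq.compl)]
  refine (lintegral_congr_ae ?_).trans lintegral_zero
  filter_upwards [h] with τ hτ
  have hmp := measurePreserving_select fun _ : Fin n => firstFresh hK
  have hz : ∀ᵐ z ∂(pointsLaw n), q (ofLog τ, z) := by
    have hqz : MeasurableSet {z | q (ofLog τ, z)} := measurable_prodMk_left hq
    rw [← hmp.map_eq, ae_map_iff hmp.measurable.aemeasurable hqz]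
    exact hτ
  rw [mul_eq_zero]
  right
  refine (lintegral_congr_ae ?_).trans lintegral_zero
  filter_upwards [hz] with z hz
  rw [Set.indicator_of_notMem (show (ofLog τ, z) ∉ {x | q x}ᶜ from fun h' => h' hz), mul_zero]

/-- The single branch "accept, then take the first fresh point in every group" already charges every
set of positive joint measure. -/
theorem Model.jointMeasure_absolutelyContinuous (M : Model n) (ha : 0 < M.a) (hb : 0 < M.b)
    (hK : 1 < K) {vε vs : ℝ≥0} (hvε : 0 < vε) (hvs : 0 < vs) {x : State n}
    (hx : x ∈ M.stateSpace) : M.jointMeasure ≪ M.mcmcKernel K vε vs x := by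
  refine Measure.AbsolutelyContinuous.mk fun B hB h0 => ?_
  obtain ⟨θ, z⟩ := x
  obtain ⟨τ, rfl⟩ : ∃ τ, θ = ofLog τ := ⟨_, (ofLog_log hx.1).symm⟩
  have hf : Measurable (B.indicator (1 : State n → ℝ≥0∞)) := measurable_one.indicator hB
  rw [← lintegral_indicator_one hB, M.lintegral_mcmcKernel_ofLog hvε hvs τ z hf,
    lintegral_eq_zero_iff (by
      refine (by fun_prop : Measurable fun τ' => stepDensity vε vs τ τ').mul ?_
      exact Measurable.lintegral_prod_right'
        (f := fun q : (ℝ × ℝ) × (Fin n → Fresh K → ℝ × ℝ) =>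
          ENNReal.ofReal (M.accept (ofLog τ) (ofLog q.1) (assemble z q.2)) *
            M.selectMean (B.indicator 1) (ofLog q.1) (assemble z q.2) +
          (1 - ENNReal.ofReal (M.accept (ofLog τ) (ofLog q.1) (assemble z q.2))) *
            M.selectMean (B.indicator 1) (ofLog τ) (assemble z q.2)) (by fun_prop))] at h0
  have key : ∀ᵐ x ∂M.jointMeasure, x ∈ M.stateSpace → x ∉ B := by
    refine M.ae_jointMeasure_of_fresh ha hb hK
      (M.measurableSet_stateSpace.himp hB.compl) ?_
    filter_upwards [h0] with τ' hτ'
    have h1 := (mul_eq_zero.1 hτ').resolve_left (stepDensity_ne_zero hvε hvs _ _)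
    rw [lintegral_eq_zero_iff (by fun_prop)] at h1
    filter_upwards [h1] with y hy hyS hyB
    obtain ⟨hacc, hsel⟩ := M.accept_assemble_pos ha hb hK hx hyS
    have h2 := (mul_eq_zero.1 (add_eq_zero.1 hy).1).resolve_left (ENNReal.ofReal_pos.2 hacc).ne'
    have h3 := Finset.sum_eq_zero_iff.1 h2 (fun _ => ⟨1, hK⟩) (Finset.mem_univ _)
    rw [assemble_one hK, Set.indicator_of_mem hyB] at h3
    simp [hsel] at h3
  have hS : ∀ᵐ x ∂M.jointMeasure, x ∈ M.stateSpace := M.jointMeasure_compl_stateSpace ha hb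
  rw [← compl_compl B]
  exact (hS.and key).mono fun x hx => hx.2 hx.1

theorem Model.not_ae_accept_eq_zero (M : Model n) (ha : 0 < M.a) (hb : 0 < M.b) (hK : 1 < K)
    (hJ : M.jointMeasure Set.univ ≠ 0) {x : State n} (hx : x ∈ M.stateSpace) :
    ¬ ∀ᵐ τ : ℝ × ℝ, ∀ᵐ y ∂(freshLaw n K),
      ENNReal.ofReal (M.accept x.1 (ofLog τ) (assemble x.2 y)) = 0 := by
  intro h
  have key : ∀ᵐ x ∂M.jointMeasure, x ∉ M.stateSpace := by
    refine M.ae_jointMeasure_of_fresh ha hb hK M.measurableSet_stateSpace.compl ?_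
    filter_upwards [h] with τ hτ
    filter_upwards [hτ] with y hy hyS
    exact (ENNReal.ofReal_pos.2 (M.accept_assemble_pos ha hb hK hx hyS).1).ne' hy
  have hS : ∀ᵐ x ∂M.jointMeasure, x ∈ M.stateSpace := M.jointMeasure_compl_stateSpace ha hb
  have : ∀ᵐ x ∂M.jointMeasure, False := (hS.and key).mono fun x hx => hx.2 hx.1
  rw [ae_iff] at this
  simp at this
  exact hJ (by simp [this])

/-- On the state space the weight and the proposal density are positive and acceptance is not almost
surely impossible, so only `h` can make the integrand vanish. -/
theorem Model.ae_points_eq_zero_of_lintegral_accept (M : Model n) (ha : 0 < M.a) (hb : 0 < M.b)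
    (hK : 1 < K) (hJ : M.jointMeasure Set.univ ≠ 0) {vε vs : ℝ≥0} (hvε : 0 < vε) (hvs : 0 < vs)
    {h : State n → ℝ≥0∞} (hm : Measurable h) (τ : ℝ × ℝ)
    (hint : ∫⁻ z, M.prodWeight (ofLog τ) z * (∫⁻ τ', stepDensity vε vs τ τ' *
      ∫⁻ y, ENNReal.ofReal (M.accept (ofLog τ) (ofLog τ') (assemble z y)) *
        h (ofLog τ, z) ∂(freshLaw n K)) ∂(pointsLaw n) = 0) :
    ∀ᵐ z ∂(pointsLaw n), (ofLog τ, z) ∈ M.stateSpace → h (ofLog τ, z) = 0 := by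
  have hG : Measurable fun r : ((Fin n → ℝ × ℝ) × (ℝ × ℝ)) × (Fin n → Fresh K → ℝ × ℝ) =>
      ENNReal.ofReal (M.accept (ofLog τ) (ofLog r.1.2) (assemble r.1.1 r.2)) *
        h (ofLog τ, r.1.1) := by fun_prop
  have hI1 : Measurable fun r : (Fin n → ℝ × ℝ) × (ℝ × ℝ) =>
      ∫⁻ y, ENNReal.ofReal (M.accept (ofLog τ) (ofLog r.2) (assemble r.1 y)) *
        h (ofLog τ, r.1) ∂(freshLaw n K) := hG.lintegral_prod_right'
  have hI2 : Measurable fun r : (Fin n → ℝ × ℝ) × (ℝ × ℝ) => stepDensity vε vs τ r.2 *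
      ∫⁻ y, ENNReal.ofReal (M.accept (ofLog τ) (ofLog r.2) (assemble r.1 y)) *
        h (ofLog τ, r.1) ∂(freshLaw n K) := by fun_prop
  have hI3 : Measurable fun z => ∫⁻ τ', stepDensity vε vs τ τ' *
      ∫⁻ y, ENNReal.ofReal (M.accept (ofLog τ) (ofLog τ') (assemble z y)) *
        h (ofLog τ, z) ∂(freshLaw n K) := hI2.lintegral_prod_right'
  rw [lintegral_eq_zero_iff (by fun_prop)] at hint
  filter_upwards [hint] with z hz hzS
  have hW : M.prodWeight (ofLog τ) z ≠ 0 :=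
    M.prodWeight_ne_zero_iff.2 ((M.mem_stateSpace_iff ha hb _).1 hzS).2.2
  have hz1 : ∫⁻ τ', stepDensity vε vs τ τ' *
      ∫⁻ y, ENNReal.ofReal (M.accept (ofLog τ) (ofLog τ') (assemble z y)) *
        h (ofLog τ, z) ∂(freshLaw n K) = 0 := by
    simpa only [Pi.zero_apply, mul_eq_zero, hW, false_or] using hz
  have hI2z : Measurable fun τ' => stepDensity vε vs τ τ' *
      ∫⁻ y, ENNReal.ofReal (M.accept (ofLog τ) (ofLog τ') (assemble z y)) *
        h (ofLog τ, z) ∂(freshLaw n K) := by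
    have := hI1.comp (measurable_prodMk_left (x := z))
    exact Measurable.mul (by fun_prop) this
  rw [lintegral_eq_zero_iff hI2z] at hz1
  by_contra hne
  refine M.not_ae_accept_eq_zero ha hb hK hJ hzS ?_
  filter_upwards [hz1] with τ' hτ'
  have hy := (mul_eq_zero.1 hτ').resolve_left (stepDensity_ne_zero hvε hvs _ _)
  rw [lintegral_eq_zero_iff (by fun_prop)] at hy
  filter_upwards [hy] with y hy
  exact (mul_eq_zero.1 hy).resolve_right hne

/-- A bounded subharmonic function that vanishes almost everywhere vanishes, for every initial
parameter, at almost all initial points. -/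
theorem Model.ae_points_eq_zero_of_subharmonic (M : Model n) (ha : 0 < M.a) (hb : 0 < M.b)
    (hK : 1 < K) (hJ : M.jointMeasure Set.univ ≠ 0) {vε vs : ℝ≥0} (hvε : 0 < vε) (hvs : 0 < vs)
    {h : State n → ℝ≥0∞} (hm : Measurable h) (h1 : ∀ x, h x ≤ 1)
    (hsub : ∀ x, h x ≤ ∫⁻ y, h y ∂(M.mcmcKernel K vε vs x)) (h0 : ∀ᵐ x ∂M.jointMeasure, h x = 0)
    (τ : ℝ × ℝ) : ∀ᵐ z ∂(pointsLaw n), (ofLog τ, z) ∈ M.stateSpace → h (ofLog τ, z) = 0 := by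
  have hK0 : 0 < K := zero_lt_one.trans hK
  set I := ∫⁻ z, M.prodWeight (ofLog τ) z * h (ofLog τ, z) ∂(pointsLaw n) with hI
  have hIfin : I ≠ ∞ := by
    rw [hI, ← M.lintegral_prodWeight_mul]
    refine ne_top_of_le_ne_top ?_ ((lintegral_mono fun z =>
      mul_le_of_le_one_right' (h1 _)).trans (M.lintegral_prodWeight_le _))
    exact ENNReal.prod_ne_top fun j _ =>
      ENNReal.mul_ne_top (ENNReal.natCast_ne_top _) (ENNReal.natCast_ne_top _)
  -- Accepted moves: for almost every `τ'` the function vanishes at almost all points of the state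
  -- space over `τ'`, hence at every state that can be selected.
  have hacc0 : ∀ᵐ τ' : ℝ × ℝ, ∀ᵐ p ∂(gridLaw n K),
      ENNReal.ofReal (M.accept (ofLog τ) (ofLog τ') p) * M.selectMean h (ofLog τ') p = 0 := by
    have hint : ∫⁻ x, h x ∂M.jointMeasure = 0 := (lintegral_congr_ae h0).trans lintegral_zero
    rw [M.lintegral_jointMeasure_ofLog ha hb hm, lintegral_eq_zero_iff (by
      refine (by fun_prop : Measurable fun τ' => M.logPrior (ofLog τ')).mul ?_
      exact Measurable.lintegral_prod_right' (f := fun q : (ℝ × ℝ) × (Fin n → ℝ × ℝ) =>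
        M.prodWeight (ofLog q.1) q.2 * h (ofLog q.1, q.2)) (by fun_prop))] at hint
    filter_upwards [hint] with τ' hτ'
    rcases mul_eq_zero.1 hτ' with hP | hP
    · refine ae_of_all _ fun p => M.accept_mul_selectMean_eq_zero ha hb _ fun k hk => ?_
      have hk' := (M.mem_stateSpace_iff ha hb _).1 hk
      exact absurd hP (ENNReal.ofReal_pos.2 (mul_pos hk'.2.1 hk'.1)).ne'
    · rw [lintegral_eq_zero_iff (by fun_prop)] at hP
      have hk : ∀ᵐ p ∂(gridLaw n K), ∀ k : Fin n → Fin K,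
          M.prodWeight (ofLog τ') (fun j => p j (k j)) * h (ofLog τ', fun j => p j (k j)) = 0 :=
        ae_all_iff.2 fun k => (measurePreserving_select k).quasiMeasurePreserving.ae hP
      filter_upwards [hk] with p hp
      refine M.accept_mul_selectMean_eq_zero ha hb _ fun k hk => ?_
      exact (mul_eq_zero.1 (hp k)).resolve_left
        (M.prodWeight_ne_zero_iff.2 ((M.mem_stateSpace_iff ha hb _).1 hk).2.2)
  set X : ℝ × ℝ → ℝ≥0∞ := fun τ' => ∫⁻ p, M.prodWeight (ofLog τ) (fun j => p j ⟨0, hK0⟩) *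
    ((1 - ENNReal.ofReal (M.accept (ofLog τ) (ofLog τ') p)) *
      h (ofLog τ, fun j => p j ⟨0, hK0⟩)) ∂(gridLaw n K)
  set Y : ℝ × ℝ → ℝ≥0∞ := fun τ' => ∫⁻ p, M.prodWeight (ofLog τ) (fun j => p j ⟨0, hK0⟩) *
    (ENNReal.ofReal (M.accept (ofLog τ) (ofLog τ') p) *
      h (ofLog τ, fun j => p j ⟨0, hK0⟩)) ∂(gridLaw n K)
  have hY : Measurable Y := Measurable.lintegral_prod_right'
    (f := fun q : (ℝ × ℝ) × (Fin n → Fin K → ℝ × ℝ) =>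
      M.prodWeight (ofLog τ) (fun j => q.2 j ⟨0, hK0⟩) *
      (ENNReal.ofReal (M.accept (ofLog τ) (ofLog q.1) q.2) *
        h (ofLog τ, fun j => q.2 j ⟨0, hK0⟩))) (by fun_prop)
  -- Subharmonicity at fixed `τ`, where only the rejected part `X` survives.
  have hle : I ≤ ∫⁻ τ', stepDensity vε vs τ τ' * X τ' := by
    calc I ≤ ∫⁻ z, M.prodWeight (ofLog τ) z *
          ∫⁻ y, h y ∂(M.mcmcKernel K vε vs (ofLog τ, z)) ∂(pointsLaw n) :=
          lintegral_mono fun z => mul_le_mul_right (hsub _) _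
      _ = ∫⁻ τ', stepDensity vε vs τ τ' * X τ' := by
          rw [M.lintegral_prodWeight_mul_mcmcKernel hK0 hvε hvs τ hm]
          refine lintegral_congr_ae ?_
          filter_upwards [hacc0] with τ' hτ'
          have : ∫⁻ p, M.prodWeight (ofLog τ) (fun j => p j ⟨0, hK0⟩) *
              (ENNReal.ofReal (M.accept (ofLog τ) (ofLog τ') p) * M.selectMean h (ofLog τ') p)
              ∂(gridLaw n K) = 0 := by
            refine (lintegral_congr_ae ?_).trans lintegral_zero
            filter_upwards [hτ'] with p hp
            rw [hp, mul_zero]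
          rw [this, zero_add]
  have hsum : (∫⁻ τ', stepDensity vε vs τ τ' * Y τ') +
      ∫⁻ τ', stepDensity vε vs τ τ' * X τ' = I := by
    have hs : Measurable fun τ' => stepDensity vε vs τ τ' := by fun_prop
    have hsY : Measurable fun τ' => stepDensity vε vs τ τ' * Y τ' := hs.mul hY
    rw [← lintegral_add_left hsY]
    simp only [← mul_add]
    have : ∀ τ', Y τ' + X τ' = I := fun τ' =>
      M.lintegral_accept_add_reject ⟨0, hK0⟩ (ofLog τ) (ofLog τ') hm
    simp only [this]
    rw [lintegral_mul_const _ hs, lintegral_stepDensity hvε hvs, one_mul]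
  -- The parts `X` and `Y` add up to the finite quantity `I`, which the `X` part already exhausts.
  have hYint : ∫⁻ τ', stepDensity vε vs τ τ' * Y τ' = 0 := by
    have h2 : (∫⁻ τ', stepDensity vε vs τ τ' * Y τ') + I ≤ 0 + I := by
      rw [zero_add]
      exact (add_le_add_right hle _).trans hsum.le
    exact nonpos_iff_eq_zero.1 ((ENNReal.add_le_add_iff_right hIfin).1 h2)
  have hC : Measurable fun r : (ℝ × ℝ) × (Fin n → Fin K → ℝ × ℝ) =>
      ENNReal.ofReal (M.accept (ofLog τ) (ofLog r.1) r.2) *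
        h (ofLog τ, fun j => r.2 j ⟨0, hK0⟩) := by fun_prop
  rw [← lintegral_mul_lintegral_assemble hK0 (w := M.prodWeight (ofLog τ)) (by fun_prop)
    (q := stepDensity vε vs τ) (by fun_prop) hC] at hYint
  simp only [assemble_zero hK0] at hYint
  exact M.ae_points_eq_zero_of_lintegral_accept ha hb hK hJ hvε hvs hm τ hYint

/-! ### Ergodicity of the chain -/

theorem Model.posterior_absolutelyContinuous (M : Model n) : M.posterior ≪ M.jointMeasure :=
  Measure.smul_absolutelyContinuous

theorem Model.jointMeasure_absolutelyContinuous_posterior (M : Model n)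
    (hJ : M.jointMeasure Set.univ ≠ ∞) : M.jointMeasure ≪ M.posterior :=
  Measure.absolutelyContinuous_smul (ENNReal.inv_ne_zero.2 hJ)

theorem Model.invariant_posterior (M : Model n) (ha : 0 < M.a) (hb : 0 < M.b) (hK : 0 < K)
    {vε vs : ℝ≥0} (hvε : 0 < vε) (hvs : 0 < vs) :
    (M.mcmcKernel K vε vs).Invariant M.posterior := by
  refine Measure.ext fun B hB => ?_
  rw [Measure.bind_apply hB (Kernel.aemeasurable _), Model.posterior, lintegral_smul_measure,
    Measure.smul_apply]
  congr 1
  have := M.lintegral_mcmcKernel_jointMeasure ha hb hK hvε hvs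
    (measurable_one.indicator (β := ℝ≥0∞) hB)
  simpa only [lintegral_indicator_one hB] using this

/-- A kernel whose transition probabilities from `S` dominate `π` has no cycles. -/
theorem measure_cycle_eq_zero {Ω : Type*} [MeasurableSpace Ω] {P : Kernel Ω Ω} {S : Set Ω}
    {π : Measure Ω} (hS : π Sᶜ = 0) (hac : ∀ x ∈ S, π ≪ P x) {d : ℕ} (hd : 2 ≤ d)
    {D : ZMod d → Set Ω} (hdisj : Pairwise fun i j => Disjoint (D i) (D j))
    (hD : ∀ i, ∀ x ∈ D i, P x (D (i + 1))ᶜ = 0) (i : ZMod d) : π (D i) = 0 := by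
  by_contra hne
  obtain ⟨x, hxD, hxS⟩ : (D i ∩ S).Nonempty := by
    by_contra h
    rw [Set.not_nonempty_iff_eq_empty, ← Set.disjoint_iff_inter_eq_empty] at h
    exact hne (measure_mono_null h.subset_compl_right hS)
  have : Fact (1 < d) := ⟨hd⟩
  -- As `d ≥ 2`, the next set of the cycle is disjoint from `D i`; so `D i` is `P x`-null, hence
  -- `π`-null.
  have hi : i ≠ i + 1 := fun h => one_ne_zero (left_eq_add.1 h)
  exact hne (hac x hxS (measure_mono_null (hdisj hi).subset_compl_right (hD i x hxD)))

end DPEst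

theorem mainTheorem1 {n : ℕ} (hn : 1 ≤ n) (M : DPEst.Model n)
    (hδ0 : 0 ≤ M.δ) (hδ1 : M.δ ≤ 1) (hσ : 0 < M.σ2) (ha : 0 < M.a) (hb : 0 < M.b)
    (hX : ∀ i, M.X i ≤ M.N0 i) (hY : ∀ i, M.Y i ≤ M.N1 i)
    (K : ℕ) (hK : 1 < K) (vε vs : ℝ≥0) (hvε : 0 < vε) (hvs : 0 < vs) :
    DPEst.IsErgodicChain (M.mcmcKernel K vε vs) M.stateSpace M.posterior ∧
    ∀ ε s : ℝ, 0 < ε → 0 < s → s < 1 →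
      ∀ᵐ z : Fin n → ℝ × ℝ, ((ε, s), z) ∈ M.stateSpace →
        Tendsto (fun m : ℕ =>
          DPEst.tvDist (((M.mcmcKernel K vε vs) ^ m) ((ε, s), z)) M.posterior) atTop (𝓝 0) := by
  have hK0 : 0 < K := zero_lt_one.trans hK
  have hJ0 := M.jointMeasure_univ_ne_zero hδ0 hδ1 hσ ha hb hX hY
  have hJ := M.jointMeasure_univ_ne_top hσ ha hb
  have hP : IsMarkovKernel (M.mcmcKernel K vε vs) := M.isMarkovKernel_mcmcKernel hK0 vε vs
  have hπ : IsProbabilityMeasure M.posterior :=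
    ⟨by rw [DPEst.Model.posterior, Measure.smul_apply, smul_eq_mul, ENNReal.inv_mul_cancel hJ0 hJ]⟩
  have hcarried : M.posterior M.stateSpaceᶜ = 0 :=
    M.posterior_absolutelyContinuous (M.jointMeasure_compl_stateSpace ha hb)
  have hinv := M.invariant_posterior ha hb hK0 hvε hvs
  have hac : ∀ x ∈ M.stateSpace, M.posterior ≪ M.mcmcKernel K vε vs x := fun x hx =>
    M.posterior_absolutelyContinuous.trans
      (M.jointMeasure_absolutelyContinuous ha hb hK hvε hvs hx)
  have hS : ∀ᵐ x ∂M.posterior, x ∈ M.stateSpace := hcarried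
  obtain ⟨h, hm, h1, hsub, h0, hconv⟩ :=
    DPEst.exists_subharmonic_of_absolutelyContinuous hinv (hS.mono hac)
  refine ⟨⟨hP, M.measurableSet_stateSpace,
    fun x hx => M.mcmcKernel_compl_stateSpace ha hb hK0 vε vs hx, hπ, hcarried, hinv,
    fun μ _ hμS hμ => DPEst.invariant_unique hinv hcarried hac hμS hμ, fun x hx A _ hA => ?_,
    fun d hd D _ hdisj hD i => DPEst.measure_cycle_eq_zero hcarried hac hd hdisj hD i,
    h0.mono hconv⟩, fun ε s hε _ _ => ?_⟩
  -- One step suffices, by domination.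
  · refine ⟨1, one_pos, pos_iff_ne_zero.2 fun h => hA.ne' (hac x hx ?_)⟩
    rwa [pow_one] at h
  · have key := M.ae_points_eq_zero_of_subharmonic ha hb hK hJ0 hvε hvs hm h1 hsub
      ((M.jointMeasure_absolutelyContinuous_posterior hJ).ae_le h0) (Real.log ε, s)
    -- The law of the points is Lebesgue measure on the cube, which contains all points of the state
    -- space; so the exceptional set is Lebesgue-null.
    rw [DPEst.ofLog_log (θ := (ε, s)) hε, DPEst.pointsLaw_eq_restrict,
      ae_restrict_iff' (DPEst.measurableSet_cube n)] at key
    filter_upwards [key] with z hz hzS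
    refine hconv _ (hz (fun j _ => ?_) hzS)
    exact DPEst.mem_square_of_weight_pos M (((M.mem_stateSpace_iff ha hb _).1 hzS).2.2 j)
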